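/- Let $I$ be a finite alphabet with at least two elements. For each $i\in I$ let $A_i(x_1,x_2)=(a_i x_1+v_{i,1},\,b_i x_2+v_{i,2})$ be an affine map of $\mathbb{R}^2$ with $|a_i|,|b_i|\in(0,1)$ and $A_i([0,1]^2)\subseteq[0,1]^2$. Assume the rectangular open set condition: there is an open rectangle $U=(p_1,q_1)\times(p_2,q_2)\subseteq[0,1]^2$ with $p_k<q_k$ for $k=1,2$, such that $A_i(U)\subseteq U$ for all $i\in I$ and $A_i(U)\cap A_j(U)=\emptyset$ for all distinct $i,j\in I$. Let $$F=\bigcup_{\omega\in I^{\mathbb{N}}}\ \bigcap_{n\ge 1} A_{\omega_1}\circ\cdots\circ A_{\omega_n}([0,1]^2)$$ be the limit set of $\{A_i: i\in I\}$, and let $\pi_1,\pi_2$ be the projections of $\mathbb{R}^2$ onto the first and second coordinate. Then the box-counting dimensions $r_1=\dim_B\pi_1(F)$ and $r_2=\dim_B\pi_2(F)$ exist, there is a unique real $t>0$ with $$\max\left\{\sum_{i\in I}|a_i|^{r_1}|b_i|^{t-r_1},\ \sum_{i\in I}|b_i|^{r_2}|a_i|^{t-r_2}\right\}=1,$$ the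 box-counting dimension of $F$ exists, and $\dim_B F=\dim_P F=t$, where $\dim_P$ denotes the packing dimension. -/

import Mathlib

open Set Filter Topology
open scoped ENNReal NNReal

noncomputable section

/-! ## Box-counting dimension -/

/-- `N_δ(F)`: the smallest cardinality of a cover of `F` by sets of diameter at most `δ`. -/
def deltaCoverNumber {X : Type*} [PseudoEMetricSpace X] (δ : ℝ) (F : Set X) : ℕ∞ :=
  ⨅ (C : Set (Set X)) (_ : F ⊆ ⋃₀ C) (_ : ∀ U ∈ C, Metric.ediam U ≤ ENNReal.ofReal δ), C.encard

/-- The quotient `log N_δ(F) / (- log δ)`, as an extended real number. -/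
def boxQuotient {X : Type*} [PseudoEMetricSpace X] (F : Set X) (δ : ℝ) : EReal :=
  ENNReal.log (deltaCoverNumber δ F : ℝ≥0∞) / ((-Real.log δ : ℝ) : EReal)

/-- The lower box-counting dimension. -/
def lowerBoxDim {X : Type*} [PseudoEMetricSpace X] (F : Set X) : EReal :=
  liminf (boxQuotient F) (𝓝[>] (0 : ℝ))

/-- The upper box-counting dimension. -/
def upperBoxDim {X : Type*} [PseudoEMetricSpace X] (F : Set X) : EReal :=
  limsup (boxQuotient F) (𝓝[>] (0 : ℝ))

/-- The box-counting dimension of `F` exists and is equal to `d`. -/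
def HasBoxDim {X : Type*} [PseudoEMetricSpace X] (F : Set X) (d : ℝ) : Prop :=
  lowerBoxDim F = (d : EReal) ∧ upperBoxDim F = (d : EReal)

/-! ## Packing dimension -/

/-- A collection of balls, coded by the pairs (centre, radius), is a `δ`-packing of `F` if the
centres lie in `F`, the radii lie in `(0, δ]`, and the closed balls are pairwise disjoint. -/
def IsBallPacking {X : Type*} [PseudoMetricSpace X] (δ : ℝ) (F : Set X) (T : Set (X × ℝ)) : Prop :=
  (∀ p ∈ T, p.1 ∈ F ∧ 0 < p.2 ∧ p.2 ≤ δ) ∧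
    T.PairwiseDisjoint (fun p => Metric.closedBall p.1 p.2)

/-- `𝒫^s_δ(F)`: the supremum of the sums of the `s`-th powers of the diameters `2 r` of the balls,
over all `δ`-packings of `F`. -/
def packingPreDelta {X : Type*} [PseudoMetricSpace X] (s : ℝ≥0) (δ : ℝ) (F : Set X) : ℝ≥0∞ :=
  ⨆ (T : Set (X × ℝ)) (_ : IsBallPacking δ F T), ∑' p : T, ENNReal.ofReal (2 * p.1.2) ^ (s : ℝ)

/-- The `s`-dimensional packing pre-measure: the limit of `𝒫^s_δ(F)` as `δ` decreases to `0`. -/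
def packingPre {X : Type*} [PseudoMetricSpace X] (s : ℝ≥0) (F : Set X) : ℝ≥0∞ :=
  ⨅ (δ : ℝ) (_ : 0 < δ), packingPreDelta s δ F

/-- The `s`-dimensional packing (outer) measure. -/
def packingMeasure {X : Type*} [PseudoMetricSpace X] (s : ℝ≥0) (F : Set X) : ℝ≥0∞ :=
  ⨅ (E : ℕ → Set X) (_ : F ⊆ ⋃ n, E n), ∑' n, packingPre s (E n)

/-- The packing dimension `inf {s ≥ 0 : 𝒫^s(F) = 0}`. -/
def packingDim {X : Type*} [PseudoMetricSpace X] (F : Set X) : ℝ≥0∞ :=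
  ⨅ (s : ℝ≥0) (_ : packingMeasure s F = 0), (s : ℝ≥0∞)

/-! ## Iterated function systems -/

/-- `prefixMap φ ω n` is the composition `φ (ω 0) ∘ φ (ω 1) ∘ ⋯ ∘ φ (ω (n - 1))`. -/
def prefixMap {I X : Type*} (φ : I → X → X) (ω : ℕ → I) : ℕ → X → X
  | 0 => id
  | n + 1 => prefixMap φ ω n ∘ φ (ω n)

/-- The limit set of an iterated function system `φ` on `S`: the points which, for some infinite
sequence `ω` of digits, lie in the sets `φ (ω 0) ∘ ⋯ ∘ φ (ω (n - 1)) (S)` for all `n`. -/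
def limitSet {I X : Type*} (φ : I → X → X) (S : Set X) : Set X :=
  ⋃ ω : ℕ → I, ⋂ n : ℕ, prefixMap φ ω n '' S

/-- The Euclidean plane. -/
abbrev Plane : Type := EuclideanSpace ℝ (Fin 2)

/-- The unit square `[0,1]²`. -/
def unitSquare : Set Plane := {x | ∀ k, x k ∈ Icc (0 : ℝ) 1}

/-- The open rectangle `(p 0, q 0) × (p 1, q 1)`. -/
def openRect (p q : Fin 2 → ℝ) : Set Plane := {x | ∀ k, x k ∈ Ioo (p k) (q k)}

/-- The rectangular open set condition for maps `φ i` of `S` into itself: some non-empty open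
rectangle `U ⊆ S` satisfies `φ i (U) ⊆ U` for all `i` and `φ i (U) ∩ φ j (U) = ∅` for `i ≠ j`. -/
def ROSC {I : Type*} (φ : I → Plane → Plane) (S : Set Plane) : Prop :=
  ∃ p q : Fin 2 → ℝ, (∀ k, p k < q k) ∧ openRect p q ⊆ S ∧
    (∀ i, φ i '' openRect p q ⊆ openRect p q) ∧
    ∀ i j, i ≠ j → Disjoint (φ i '' openRect p q) (φ j '' openRect p q)

/-- The affine map of the plane with linear part `diag(a, b)` and translation vector `v`. -/
def diagAffine (a b : ℝ) (v : Plane) (x : Plane) : Plane :=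
  !₂[a * x 0 + v 0, b * x 1 + v 1]

end

/-! Fix a scale δ and cut F into the cylinders A_w(F) whose shorter side is comparable to δ; the
words w form a finite complete family. Such a cylinder is about δ thick, so at scale δ it looks like
a copy of a projection of F stretched along its longer side. If α ≥ β are its width and height, its
covering number is comparable to that of π₁(F) at scale δ/α (`coverCount_wordMap_image_bounds`). By
the rectangular open set condition a set of diameter δ meets boundedly many of these cylinders
(`exists_card_meeting_le`), so N_δ(F) is comparable to the sum of the slice counts.

The projections are self-similar sets on the line, possibly with overlaps. Their covering numbers
are supermultiplicative up to constants, so Fekete's lemma gives N_δ = δ^(-r) up to subpolynomial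
factors (`exists_hasGrowth_of_selfSimilar`). A slice count is therefore about δ^(-t) α^r₁ β^(t-r₁),
or the same with the axes exchanged. These weights are multiplicative in the word, so their sums
over a complete family are compared with 1 letter by letter.

For the upper bound both weight sums are at most 1. For the lower bound only the sum attaining the
maximum is known to be 1, so every slice must dominate both weights. This holds when t ≤ r₁ + r₂
(`rpow_mul_rpow_le_swap`). That inequality follows from ∑ |a_i|^r₁ |b_i|^r₂ ≤ 1
(`sum_rpow_mul_rpow_le_one`), since otherwise F would need more sets than the product of its
projections does.

The packing dimension is at most t by counting balls of dyadic radii. It is at least t by Baire's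
theorem on the sequence space: if countably many pieces cover F, the closure of one of them contains
a whole cylinder, whose covering numbers grow like those of F. -/

/-! ### Covering numbers and separated sets. -/

section CoverNumber

variable {X Y : Type*}

theorem deltaCoverNumber_le_encard [PseudoEMetricSpace X] {δ : ℝ} {F : Set X} {C : Set (Set X)}
    (hF : F ⊆ ⋃₀ C) (hC : ∀ U ∈ C, Metric.ediam U ≤ ENNReal.ofReal δ) :
    deltaCoverNumber δ F ≤ C.encard :=
  iInf_le_of_le C <| iInf_le_of_le hF <| iInf_le _ hC

theorem exists_cover_encard_eq [PseudoEMetricSpace X] (δ : ℝ) (F : Set X) :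
    ∃ C : Set (Set X), F ⊆ ⋃₀ C ∧ (∀ U ∈ C, Metric.ediam U ≤ ENNReal.ofReal δ) ∧
      C.encard = deltaCoverNumber δ F := by
  let T := {C : Set (Set X) // F ⊆ ⋃₀ C ∧ ∀ U ∈ C, Metric.ediam U ≤ ENNReal.ofReal δ}
  have : Nonempty T := by
    refine ⟨⟨range fun x => {x}, fun x _ => ⟨{x}, ⟨x, rfl⟩, rfl⟩, ?_⟩⟩
    rintro _ ⟨x, rfl⟩
    simp
  obtain ⟨C, hC⟩ := ENat.exists_eq_iInf (fun C : T => C.1.encard)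
  refine ⟨C.1, C.2.1, C.2.2, ?_⟩
  rw [hC, deltaCoverNumber, iInf_subtype]
  refine iInf_congr fun D => ?_
  rw [iInf_and]

theorem exists_finite_cover [PseudoEMetricSpace X] {δ : ℝ} {F : Set X}
    (h : deltaCoverNumber δ F ≠ ⊤) :
    ∃ C : Finset (Set X), F ⊆ ⋃₀ (C : Set (Set X)) ∧
      (∀ U ∈ C, Metric.ediam U ≤ ENNReal.ofReal δ) ∧ (C.card : ℕ∞) = deltaCoverNumber δ F := by
  obtain ⟨C, h1, h2, h3⟩ := exists_cover_encard_eq δ F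
  have hfin : C.Finite := by rw [← Set.encard_ne_top_iff, h3]; exact h
  lift C to Finset (Set X) using hfin
  exact ⟨C, h1, h2, by rw [← h3, Set.encard_coe_eq_coe_finsetCard]⟩

theorem dist_le_of_ediam_le [PseudoMetricSpace X] {δ : ℝ} (hδ : 0 ≤ δ) {U : Set X}
    (hU : Metric.ediam U ≤ ENNReal.ofReal δ) {x y : X} (hx : x ∈ U) (hy : y ∈ U) :
    dist x y ≤ δ := by
  rw [← ENNReal.ofReal_le_ofReal_iff hδ, ← edist_dist]
  exact (Metric.edist_le_ediam_of_mem hx hy).trans hU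

theorem ediam_le_of_dist_le [PseudoMetricSpace X] {δ : ℝ} {U : Set X}
    (h : ∀ x ∈ U, ∀ y ∈ U, dist x y ≤ δ) : Metric.ediam U ≤ ENNReal.ofReal δ :=
  Metric.ediam_le fun x hx y hy => by
    rw [edist_dist]; exact ENNReal.ofReal_le_ofReal (h x hx y hy)

/-- Covers are pulled back along a map that controls distances from below. -/
theorem deltaCoverNumber_le_of_map [PseudoMetricSpace X] [PseudoMetricSpace Y]
    {δ δ' : ℝ} (hδ : 0 ≤ δ) {F : Set X} {G : Set Y} (h : Y → X) (hm : MapsTo h G F)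
    (hd : ∀ y ∈ G, ∀ y' ∈ G, dist (h y) (h y') ≤ δ → dist y y' ≤ δ') :
    deltaCoverNumber δ' G ≤ deltaCoverNumber δ F := by
  obtain ⟨C, h1, h2, h3⟩ := exists_cover_encard_eq δ F
  rw [← h3]
  refine (deltaCoverNumber_le_encard (C := (fun V => G ∩ h ⁻¹' V) '' C) ?_ ?_).trans
    (Set.encard_image_le _ _)
  · intro y hy
    obtain ⟨V, hV, hyV⟩ := h1 (hm hy)
    exact ⟨_, ⟨V, hV, rfl⟩, hy, hyV⟩
  · rintro _ ⟨V, hV, rfl⟩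
    exact ediam_le_of_dist_le fun y hy y' hy' =>
      hd y hy.1 y' hy'.1 (dist_le_of_ediam_le hδ (h2 V hV) hy.2 hy'.2)

theorem deltaCoverNumber_mono [PseudoEMetricSpace X] (δ : ℝ) {F G : Set X} (h : F ⊆ G) :
    deltaCoverNumber δ F ≤ deltaCoverNumber δ G := by
  obtain ⟨C, h1, h2, h3⟩ := exists_cover_encard_eq δ G
  exact h3 ▸ deltaCoverNumber_le_encard (h.trans h1) h2

theorem deltaCoverNumber_anti [PseudoEMetricSpace X] (F : Set X) {δ δ' : ℝ} (h : δ ≤ δ') :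
    deltaCoverNumber δ' F ≤ deltaCoverNumber δ F := by
  obtain ⟨C, h1, h2, h3⟩ := exists_cover_encard_eq δ F
  exact h3 ▸ deltaCoverNumber_le_encard h1 fun U hU =>
    (h2 U hU).trans (ENNReal.ofReal_le_ofReal h)

theorem one_le_deltaCoverNumber [PseudoEMetricSpace X] (δ : ℝ) {F : Set X} (h : F.Nonempty) :
    1 ≤ deltaCoverNumber δ F := by
  obtain ⟨C, h1, h2, h3⟩ := exists_cover_encard_eq δ F
  obtain ⟨x, hx⟩ := h
  obtain ⟨U, hU, -⟩ := h1 hx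
  rw [← h3, Set.one_le_encard_iff_nonempty]
  exact ⟨U, hU⟩

theorem deltaCoverNumber_biUnion_le [PseudoEMetricSpace X] {ι : Type*} (δ : ℝ) (T : Finset ι)
    (F : ι → Set X) :
    deltaCoverNumber δ (⋃ i ∈ T, F i) ≤ ∑ i ∈ T, deltaCoverNumber δ (F i) := by
  classical
  choose C h1 h2 h3 using fun i => exists_cover_encard_eq δ (F i)
  refine (deltaCoverNumber_le_encard (C := ⋃ i ∈ T, C i) ?_ ?_).trans ?_
  · intro x hx
    simp only [mem_iUnion] at hx
    obtain ⟨i, hi, hx⟩ := hx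
    obtain ⟨U, hU, hxU⟩ := h1 i hx
    exact ⟨U, by simp only [mem_iUnion]; exact ⟨i, hi, hU⟩, hxU⟩
  · intro U hU
    simp only [mem_iUnion] at hU
    obtain ⟨i, hi, hU⟩ := hU
    exact h2 i U hU
  · simp_rw [← h3]
    clear h3
    induction T using Finset.induction_on with
    | empty => simp
    | insert i T hi ih =>
      rw [Finset.sum_insert hi, Finset.set_biUnion_insert]
      exact (Set.encard_union_le _ _).trans (add_le_add le_rfl ih)

/-- Closing the members of a cover keeps their diameters, and a finite union of closures is closed;
this is where finiteness enters. -/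
theorem deltaCoverNumber_closure [PseudoEMetricSpace X] {δ : ℝ} {F : Set X}
    (h : deltaCoverNumber δ F ≠ ⊤) : deltaCoverNumber δ (closure F) ≤ deltaCoverNumber δ F := by
  obtain ⟨C, h1, h2, h3⟩ := exists_finite_cover h
  rw [← h3, ← Set.encard_coe_eq_coe_finsetCard]
  refine (deltaCoverNumber_le_encard (C := closure '' (C : Set (Set X))) ?_ ?_).trans
    (Set.encard_image_le _ _)
  · have hcl : IsClosed (⋃₀ (closure '' (C : Set (Set X)))) := by
      rw [sUnion_image]
      exact C.finite_toSet.isClosed_biUnion fun U _ => isClosed_closure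
    refine closure_minimal (fun x hx => ?_) hcl
    obtain ⟨U, hU, hxU⟩ := h1 hx
    exact ⟨_, ⟨U, hU, rfl⟩, subset_closure hxU⟩
  · rintro _ ⟨U, hU, rfl⟩
    rw [Metric.ediam_closure]
    exact h2 U hU

/-- A cover has at least as many members as there are separated points. -/
theorem encard_le_deltaCoverNumber [PseudoMetricSpace X] {ι : Type*} {δ : ℝ} (hδ : 0 ≤ δ)
    {F : Set X} {S : Set ι} {c : ι → X} (hS : MapsTo c S F)
    (hsep : S.Pairwise fun i j => δ < dist (c i) (c j)) : S.encard ≤ deltaCoverNumber δ F := by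
  obtain ⟨C, h1, h2, h3⟩ := exists_cover_encard_eq δ F
  rw [← h3]
  have hU : ∀ i ∈ S, ∃ U ∈ C, c i ∈ U := fun i hi => h1 (hS hi)
  choose! f hf hf' using hU
  refine Set.encard_le_encard_of_injOn (f := f) hf fun i hi j hj hij => ?_
  by_contra hne
  refine (hsep hi hj hne).not_ge (dist_le_of_ediam_le hδ (h2 _ (hf i hi)) (hf' i hi) ?_)
  rw [hij]
  exact hf' j hj

theorem card_le_deltaCoverNumber [PseudoMetricSpace X] {δ : ℝ} (hδ : 0 ≤ δ) {F : Set X}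
    {S : Finset X} (hS : (S : Set X) ⊆ F) (hsep : (S : Set X).Pairwise fun x y => δ < dist x y) :
    (S.card : ℕ∞) ≤ deltaCoverNumber δ F := by
  rw [← Set.encard_coe_eq_coe_finsetCard]
  exact encard_le_deltaCoverNumber hδ (c := id) hS hsep

/-- A set of finite covering number has a finite separated subset which is large. -/
theorem exists_separated [PseudoMetricSpace X] {δ : ℝ} (hδ : 0 ≤ δ) {F : Set X}
    (h : deltaCoverNumber δ F ≠ ⊤) :
    ∃ S : Finset X, (S : Set X) ⊆ F ∧ ((S : Set X).Pairwise fun x y => δ < dist x y) ∧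
      deltaCoverNumber (2 * δ) F ≤ S.card := by
  classical
  let P : ℕ → Prop := fun n => ∃ S : Finset X, (S : Set X) ⊆ F ∧
    ((S : Set X).Pairwise fun x y => δ < dist x y) ∧ S.card = n
  have hbd : ∀ n, P n → n ≤ (deltaCoverNumber δ F).toNat := by
    rintro _ ⟨S, h1, h2, rfl⟩
    have := card_le_deltaCoverNumber hδ h1 h2
    rw [← ENat.natCast_toNat h] at this
    exact_mod_cast this
  have h0 : P 0 := ⟨∅, by simp, by simp, rfl⟩
  -- A separated subset of maximal cardinality, which exists because covers bound the size of
  -- separated sets. By maximality its closed δ-balls cover F, and their diameter bound gives the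
  -- factor 2.
  obtain ⟨S, h1, h2, h3⟩ : P (Nat.findGreatest P (deltaCoverNumber δ F).toNat) :=
    Nat.findGreatest_spec (P := P) (Nat.zero_le _) h0
  refine ⟨S, h1, h2, ?_⟩
  refine (deltaCoverNumber_le_encard (C := (fun x => Metric.closedBall x δ) '' (S : Set X))
    ?_ ?_).trans ((Set.encard_image_le _ _).trans (by rw [Set.encard_coe_eq_coe_finsetCard]))
  · intro x hx
    by_contra hcon
    have hfar : ∀ y ∈ S, δ < dist x y := by
      intro y hy
      by_contra hle
      exact hcon ⟨_, ⟨y, hy, rfl⟩, not_lt.1 hle⟩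
    have hxS : x ∉ S := fun hxS => hcon ⟨_, ⟨x, hxS, rfl⟩, by simpa using hδ⟩
    have hP : P (S.card + 1) := by
      refine ⟨insert x S, ?_, ?_, Finset.card_insert_of_notMem hxS⟩
      · rw [Finset.coe_insert]; exact Set.insert_subset hx h1
      · rw [Finset.coe_insert]
        refine h2.insert fun y hy _ => ⟨hfar y hy, ?_⟩
        rw [dist_comm]; exact hfar y hy
    have := Nat.le_findGreatest (hbd _ hP) hP
    omega
  · rintro _ ⟨x, -, rfl⟩
    refine ediam_le_of_dist_le fun y hy z hz => ?_
    rw [Metric.mem_closedBall] at hy hz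
    linarith [dist_triangle_right y z x]

theorem deltaCoverNumber_unitInterval_le {δ : ℝ} (hδ : 0 < δ) {K : Set ℝ} (hK : K ⊆ Icc 0 1) :
    deltaCoverNumber δ K ≤ (⌊1 / δ⌋₊ + 1 : ℕ) := by
  -- The cells ask for `0 ≤ x` because `⌊·⌋₊` is 0 on negative numbers, which would make the cell of
  -- index 0 unbounded.
  refine (deltaCoverNumber_le_encard
    (C := (fun j : ℕ => {x : ℝ | 0 ≤ x ∧ ⌊x / δ⌋₊ = j}) ''
      (Finset.range (⌊1 / δ⌋₊ + 1) : Set ℕ)) ?_ ?_).trans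
    ((Set.encard_image_le _ _).trans
      (by rw [Set.encard_coe_eq_coe_finsetCard, Finset.card_range]))
  · intro x hx
    refine ⟨_, ⟨⌊x / δ⌋₊, ?_, rfl⟩, (hK hx).1, rfl⟩
    rw [Finset.mem_coe, Finset.mem_range, Nat.lt_succ_iff]
    exact Nat.floor_le_floor (div_le_div_of_nonneg_right (hK hx).2 hδ.le)
  · rintro _ ⟨j, -, rfl⟩
    have key : ∀ x : ℝ, 0 ≤ x → ⌊x / δ⌋₊ = j → j * δ ≤ x ∧ x < j * δ + δ := by
      rintro x h0 rfl
      have h1 := Nat.floor_le (div_nonneg h0 hδ.le)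
      have h2 := Nat.lt_floor_add_one (x / δ)
      rw [le_div_iff₀ hδ] at h1
      rw [div_lt_iff₀ hδ] at h2
      exact ⟨h1, by linarith⟩
    refine ediam_le_of_dist_le fun x hx y hy => ?_
    have hx' := key x hx.1 hx.2
    have hy' := key y hy.1 hy.2
    rw [Real.dist_eq, abs_le]
    constructor <;> linarith

/-- The number of sets of diameter at most `δ` needed to cover `F`, as a real number. -/
noncomputable def coverCount [PseudoEMetricSpace X] (F : Set X) (δ : ℝ) : ℝ :=
  ((deltaCoverNumber δ F).toNat : ℝ)

theorem ofReal_coverCount [PseudoEMetricSpace X] {F : Set X} {δ : ℝ}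
    (h : deltaCoverNumber δ F ≠ ⊤) :
    ENNReal.ofReal (coverCount F δ) = ((deltaCoverNumber δ F : ℕ∞) : ℝ≥0∞) := by
  rw [coverCount, ENNReal.ofReal_natCast]
  conv_rhs => rw [← ENat.natCast_toNat h]
  rfl

/-- Finiteness on the larger side is essential: `coverCount` has the value 0 when the covering
number is infinite. -/
theorem coverCount_le_of_le [PseudoEMetricSpace X] [PseudoEMetricSpace Y] {F : Set X} {G : Set Y}
    {δ δ' : ℝ} (hF : deltaCoverNumber δ F ≠ ⊤)
    (h : deltaCoverNumber δ' G ≤ deltaCoverNumber δ F) : coverCount G δ' ≤ coverCount F δ := by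
  unfold coverCount
  exact_mod_cast ENat.toNat_le_toNat h hF

theorem one_le_coverCount [PseudoEMetricSpace X] {F : Set X} (hF : F.Nonempty) {δ : ℝ}
    (h : deltaCoverNumber δ F ≠ ⊤) : 1 ≤ coverCount F δ := by
  have := one_le_deltaCoverNumber δ hF
  rw [← ENat.natCast_toNat h] at this
  unfold coverCount
  exact_mod_cast this

theorem coverCount_le_of_le_nat [PseudoEMetricSpace X] {F : Set X} {δ : ℝ} {n : ℕ}
    (h : deltaCoverNumber δ F ≤ n) : coverCount F δ ≤ n := by
  unfold coverCount
  exact_mod_cast ENat.toNat_le_of_le_natCast h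

end CoverNumber

/-! ### Complete families of words and multiplicative weights. -/

section CompleteFamilies

variable {I : Type*}

/-- A complete family of words: a finite family such that every infinite word has exactly one
prefix in it. -/
inductive CompleteFamily : Finset (List I) → Prop
  | leaf : CompleteFamily {[]}
  | node (T : Finset (List I)) (f : I → Finset (List I)) (hf : ∀ i, CompleteFamily (f i))
      (hT : ∀ w, w ∈ T ↔ ∃ i, ∃ u ∈ f i, w = i :: u) : CompleteFamily T

/-- The multiplicative extension of a weight to words. -/
def wordProd (p : I → ℝ) (w : List I) : ℝ := (w.map p).prod

@[simp] theorem wordProd_nil (p : I → ℝ) : wordProd p [] = 1 := rfl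

@[simp] theorem wordProd_cons (p : I → ℝ) (i : I) (w : List I) :
    wordProd p (i :: w) = p i * wordProd p w := by simp [wordProd]

theorem wordProd_pos {p : I → ℝ} (hp : ∀ i, 0 < p i) (w : List I) : 0 < wordProd p w := by
  induction w with
  | nil => simp
  | cons i w ih => rw [wordProd_cons]; exact mul_pos (hp i) ih

theorem wordProd_le_one {p : I → ℝ} (hp : ∀ i, 0 < p i) (hp1 : ∀ i, p i ≤ 1) (w : List I) :
    wordProd p w ≤ 1 := by
  induction w with
  | nil => simp
  | cons i w ih => rw [wordProd_cons]; exact mul_le_one₀ (hp1 i) (wordProd_pos hp w).le ih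

theorem wordProd_abs (p : I → ℝ) (w : List I) : wordProd (fun i => |p i|) w = |wordProd p w| := by
  induction w with
  | nil => simp
  | cons i w ih => rw [wordProd_cons, wordProd_cons, ih, abs_mul]

theorem wordProd_rpow_mul_rpow {a b : I → ℝ} (ha : ∀ i, 0 < a i) (hb : ∀ i, 0 < b i) (x y : ℝ)
    (w : List I) :
    wordProd (fun i => a i ^ x * b i ^ y) w = wordProd a w ^ x * wordProd b w ^ y := by
  induction w with
  | nil => simp
  | cons i w ih =>
    rw [wordProd_cons, ih, wordProd_cons, wordProd_cons,
      Real.mul_rpow (ha i).le (wordProd_pos ha w).le,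
      Real.mul_rpow (hb i).le (wordProd_pos hb w).le]
    ring

theorem exists_node_family [Finite I] (f : I → Finset (List I)) :
    ∃ T : Finset (List I), ∀ w, w ∈ T ↔ ∃ i, ∃ u ∈ f i, w = i :: u := by
  classical
  have := Fintype.ofFinite I
  refine ⟨Finset.univ.biUnion fun i => (f i).image (List.cons i), fun w => ?_⟩
  simp [eq_comm]

variable [Fintype I]

theorem sum_node_family {T : Finset (List I)} {f : I → Finset (List I)}
    (hT : ∀ w, w ∈ T ↔ ∃ i, ∃ u ∈ f i, w = i :: u) (g : List I → ℝ) :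
    ∑ w ∈ T, g w = ∑ i, ∑ u ∈ f i, g (i :: u) := by
  classical
  have : T = Finset.univ.biUnion fun i => (f i).image (List.cons i) := by
    ext w
    simp [hT, eq_comm]
  rw [this, Finset.sum_biUnion]
  · refine Finset.sum_congr rfl fun i _ => ?_
    rw [Finset.sum_image]
    intro u _ v _ h
    exact (List.cons.inj h).2
  · intro i _ j _ hij
    rw [Function.onFun, Finset.disjoint_left]
    simp only [Finset.mem_image, not_exists, not_and]
    rintro _ ⟨u, -, rfl⟩ v - h
    exact hij (List.cons.inj h).1.symm

/-- Replacing a word by all its one-letter extensions multiplies its weight by the sum of `p`, so a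
complete family, grown from the empty word, cannot exceed total weight 1. -/
theorem CompleteFamily.sum_le_one {T : Finset (List I)} (hT : CompleteFamily T) {p : I → ℝ}
    (hp : ∀ i, 0 < p i) (h : ∑ i, p i ≤ 1) : ∑ w ∈ T, wordProd p w ≤ 1 := by
  induction hT with
  | leaf => simp
  | node T f _ hT ih =>
    rw [sum_node_family hT]
    refine le_trans (Finset.sum_le_sum fun i _ => ?_) h
    simp_rw [wordProd_cons, ← Finset.mul_sum]
    exact mul_le_of_le_one_right (hp i).le (ih i)

theorem CompleteFamily.one_le_sum {T : Finset (List I)} (hT : CompleteFamily T) {p : I → ℝ}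
    (hp : ∀ i, 0 < p i) (h : 1 ≤ ∑ i, p i) : 1 ≤ ∑ w ∈ T, wordProd p w := by
  induction hT with
  | leaf => simp
  | node T f _ hT ih =>
    rw [sum_node_family hT]
    refine h.trans (Finset.sum_le_sum fun i _ => ?_)
    simp_rw [wordProd_cons, ← Finset.mul_sum]
    exact le_mul_of_one_le_right (hp i).le (ih i)

/-- Extend words until the smaller product first drops to `δ`. Before the last letter it exceeded
`δ`, and a letter costs at most a factor `m`, whence the lower bound. `α` and `β` are the products
accumulated so far, and `n` bounds the number of letters still needed. -/
theorem exists_completeFamily_of_pow {a b : I → ℝ} {m l δ : ℝ} (hm : 0 < m)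
    (hma : ∀ i, m ≤ a i) (hmb : ∀ i, m ≤ b i) (hal : ∀ i, a i ≤ l) (hbl : ∀ i, b i ≤ l) (n : ℕ) :
    ∀ α β : ℝ, δ < min α β → 0 < α → 0 < β → min α β * l ^ n ≤ δ →
      ∃ T : Finset (List I), CompleteFamily T ∧
        ∀ w ∈ T, m * δ < min (α * wordProd a w) (β * wordProd b w) ∧
          min (α * wordProd a w) (β * wordProd b w) ≤ δ := by
  induction n with
  | zero =>
    intro α β h _ _ h'
    rw [pow_zero, mul_one] at h'
    exact absurd h h'.not_gt
  | succ n ih =>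
    intro α β h hα hβ h'
    have hstep : ∀ i, ∃ T : Finset (List I), CompleteFamily T ∧
        ∀ w ∈ T, m * δ < min (α * wordProd a (i :: w)) (β * wordProd b (i :: w)) ∧
          min (α * wordProd a (i :: w)) (β * wordProd b (i :: w)) ≤ δ := by
      intro i
      have hai := hm.trans_le (hma i)
      have hbi := hm.trans_le (hmb i)
      have hl : 0 ≤ l := hai.le.trans (hal i)
      obtain ⟨h1, h2⟩ := lt_min_iff.1 h
      by_cases hs : min (α * a i) (β * b i) ≤ δ
      · refine ⟨{[]}, CompleteFamily.leaf, ?_⟩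
        intro w hw
        rw [Finset.mem_singleton] at hw
        subst hw
        simp only [wordProd_cons, wordProd_nil, mul_one]
        refine ⟨lt_min ?_ ?_, hs⟩
        · nlinarith [hma i]
        · nlinarith [hmb i]
      · obtain ⟨T, hT, hT'⟩ := ih (α * a i) (β * b i) (not_le.1 hs) (mul_pos hα hai)
          (mul_pos hβ hbi) (by
            refine le_trans ?_ h'
            rw [pow_succ', ← mul_assoc]
            refine mul_le_mul_of_nonneg_right ?_ (pow_nonneg hl n)
            rw [min_mul_of_nonneg _ _ hl]
            exact min_le_min (mul_le_mul_of_nonneg_left (hal i) hα.le)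
              (mul_le_mul_of_nonneg_left (hbl i) hβ.le))
        refine ⟨T, hT, fun w hw => ?_⟩
        have := hT' w hw
        simpa only [wordProd_cons, mul_assoc] using this
    choose f hf hf' using hstep
    obtain ⟨T, hT⟩ := exists_node_family f
    refine ⟨T, CompleteFamily.node T f hf hT, fun w hw => ?_⟩
    obtain ⟨i, u, hu, rfl⟩ := (hT w).1 hw
    exact hf' i u hu

/-- For every scale there is a complete family of words whose smaller weight is comparable to
this scale. -/
theorem exists_completeFamily {a b : I → ℝ} {m : ℝ} (hm : 0 < m)
    (hma : ∀ i, m ≤ a i) (hmb : ∀ i, m ≤ b i) (ha1 : ∀ i, a i < 1) (hb1 : ∀ i, b i < 1)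
    {δ : ℝ} (hδ : δ ∈ Ioo (0 : ℝ) 1) :
    ∃ T : Finset (List I), CompleteFamily T ∧
      ∀ w ∈ T, m * δ < min (wordProd a w) (wordProd b w) ∧
        min (wordProd a w) (wordProd b w) ≤ δ := by
  obtain ⟨l, hl0, hl1, hal, hbl⟩ :
      ∃ l : ℝ, 0 ≤ l ∧ l < 1 ∧ (∀ i, a i ≤ l) ∧ ∀ i, b i ≤ l := by
    rcases isEmpty_or_nonempty I with hI | hI
    · exact ⟨0, le_rfl, one_pos, fun i => isEmptyElim i, fun i => isEmptyElim i⟩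
    · obtain ⟨i, hi⟩ := Finite.exists_max fun i => max (a i) (b i)
      refine ⟨max (a i) (b i), (hm.le.trans (hma i)).trans (le_max_left _ _),
        max_lt (ha1 i) (hb1 i), fun j => (le_max_left _ _).trans (hi j),
        fun j => (le_max_right _ _).trans (hi j)⟩
  obtain ⟨n, hn⟩ := exists_pow_lt_of_lt_one hδ.1 hl1
  have := exists_completeFamily_of_pow (δ := δ) hm hma hmb hal hbl n 1 1 (by simpa using hδ.2)
    one_pos one_pos (by simpa using hn.le)
  simpa using this

end CompleteFamilies

/-! ### Power growth up to subpolynomial factors. -/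

section Growth

/-- The function `N` grows like the power `δ ^ (-r)` at `0`, up to subpolynomial factors. -/
def HasGrowth (N : ℝ → ℝ) (r : ℝ) : Prop :=
  ∀ ε : ℝ, 0 < ε → ∀ D : ℝ, 0 < D → ∃ C : ℝ, 0 < C ∧ ∀ δ ∈ Ioo 0 D,
    C⁻¹ * δ ^ (-r + ε) ≤ N δ ∧ N δ ≤ C * δ ^ (-r - ε)

theorem HasGrowth.tendsto {N : ℝ → ℝ} {r : ℝ} (h : HasGrowth N r) :
    Tendsto (fun δ => Real.log (N δ) / -Real.log δ) (𝓝[>] 0) (𝓝 r) := by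
  have hlog : Tendsto (fun δ => -Real.log δ) (𝓝[>] (0 : ℝ)) atTop :=
    tendsto_neg_atBot_atTop.comp Real.tendsto_log_nhdsGT_zero
  rw [Metric.tendsto_nhds]
  intro ε hε
  obtain ⟨C, hC, hb⟩ := h (ε / 2) (by positivity) 1 one_pos
  have h1 : ∀ᶠ δ in 𝓝[>] (0 : ℝ), δ ∈ Ioo (0 : ℝ) 1 := Ioo_mem_nhdsGT one_pos
  -- Beyond this threshold the constant `C` contributes less than `ε / 2` to the quotient.
  filter_upwards [h1, hlog.eventually_gt_atTop (|Real.log C| / (ε / 2)),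
    hlog.eventually_gt_atTop 0] with δ hδ hδ2 hδ3
  obtain ⟨hl, hu⟩ := hb δ hδ
  rw [div_lt_iff₀ (by positivity)] at hδ2
  have hN : 0 < N δ := lt_of_lt_of_le (mul_pos (inv_pos.2 hC) (Real.rpow_pos_of_pos hδ.1 _)) hl
  have hl' := Real.log_le_log (mul_pos (inv_pos.2 hC) (Real.rpow_pos_of_pos hδ.1 _)) hl
  have hu' := Real.log_le_log hN hu
  rw [Real.log_mul (inv_pos.2 hC).ne' (Real.rpow_pos_of_pos hδ.1 _).ne',
    Real.log_rpow hδ.1, Real.log_inv] at hl'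
  rw [Real.log_mul hC.ne' (Real.rpow_pos_of_pos hδ.1 _).ne', Real.log_rpow hδ.1] at hu'
  have hc1 := le_abs_self (Real.log C)
  have hc2 := neg_abs_le (Real.log C)
  rw [Real.dist_eq, abs_lt]
  constructor
  · rw [lt_sub_iff_add_lt, lt_div_iff₀ hδ3]
    nlinarith
  · rw [sub_lt_iff_lt_add, div_lt_iff₀ hδ3]
    nlinarith

theorem HasGrowth.hasBoxDim {X : Type*} [PseudoEMetricSpace X] {F : Set X} (hF : F.Nonempty)
    (hfin : ∀ δ > 0, deltaCoverNumber δ F ≠ ⊤) {r : ℝ} (h : HasGrowth (coverCount F) r) :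
    HasBoxDim F r := by
  have hlim : Tendsto (boxQuotient F) (𝓝[>] 0) (𝓝 (r : EReal)) := by
    refine ((continuous_coe_real_ereal.tendsto r).comp h.tendsto).congr' ?_
    filter_upwards [self_mem_nhdsWithin] with δ hδ
    have h1 := one_le_coverCount hF (hfin δ hδ)
    rw [boxQuotient, ← ofReal_coverCount (hfin δ hδ), ENNReal.log_ofReal_of_pos (by linarith), Function.comp_apply,
      EReal.coe_div]
  exact ⟨hlim.liminf_eq, hlim.limsup_eq⟩

/-- Only small `δ` matter: on `[δ₀ / 2, D]` the function stays between 1 and `N (δ₀ / 2)`, and the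
powers are bounded by compactness. An arbitrary `D` is wanted because slices are evaluated at `δ /
α`, which can exceed 1. -/
theorem HasGrowth.of_antitone {N : ℝ → ℝ} {r : ℝ}
    (hanti : ∀ δ δ', 0 < δ → δ ≤ δ' → N δ' ≤ N δ) (hone : ∀ δ, 0 < δ → 1 ≤ N δ)
    (h : ∀ ε : ℝ, 0 < ε → ∃ δ₀ > 0, ∃ C > 0, ∀ δ ∈ Ioo 0 δ₀,
      C⁻¹ * δ ^ (-r + ε) ≤ N δ ∧ N δ ≤ C * δ ^ (-r - ε)) : HasGrowth N r := by
  intro ε hε D hD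
  obtain ⟨δ₀, hδ₀, C, hC, hb⟩ := h ε hε
  have hd : 0 < δ₀ / 2 := by positivity
  have hcpt : IsCompact (Icc (δ₀ / 2) D) := isCompact_Icc
  have hcont : ∀ x : ℝ, ContinuousOn (fun δ : ℝ => δ ^ x) (Icc (δ₀ / 2) D) := fun x δ hδ =>
    (Real.continuousAt_rpow_const δ x (Or.inl (hd.trans_le hδ.1).ne')).continuousWithinAt
  obtain ⟨C₁, hC₁⟩ := hcpt.bddAbove_image (hcont (-r + ε))
  obtain ⟨C₂, hC₂⟩ := hcpt.bddAbove_image (hcont (r + ε))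
  refine ⟨C + |C₁| + N (δ₀ / 2) * |C₂|, ?_, fun δ hδ => ?_⟩
  · have := hone _ hd
    positivity
  have hN1 := hone _ hd
  have hpos : 0 ≤ N (δ₀ / 2) * |C₂| := by positivity
  rcases lt_or_ge δ δ₀ with hlt | hge
  · obtain ⟨h1, h2⟩ := hb δ ⟨hδ.1, hlt⟩
    have hCC : C ≤ C + |C₁| + N (δ₀ / 2) * |C₂| := by linarith [abs_nonneg C₁]
    refine ⟨le_trans ?_ h1, h2.trans ?_⟩
    · exact mul_le_mul_of_nonneg_right (inv_anti₀ hC hCC) (Real.rpow_nonneg hδ.1.le _)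
    · exact mul_le_mul_of_nonneg_right hCC (Real.rpow_nonneg hδ.1.le _)
  · have hmem : δ ∈ Icc (δ₀ / 2) D := ⟨by linarith, hδ.2.le⟩
    have h1 : δ ^ (-r + ε) ≤ C₁ := hC₁ ⟨δ, hmem, rfl⟩
    have h2 : δ ^ (r + ε) ≤ C₂ := hC₂ ⟨δ, hmem, rfl⟩
    constructor
    · refine le_trans ?_ (hone δ hδ.1)
      rw [inv_mul_le_one₀ (by positivity)]
      linarith [le_abs_self C₁]
    · refine (hanti _ _ hd hmem.1).trans ?_
      have h3 : δ ^ (-r - ε) = (δ ^ (r + ε))⁻¹ := by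
        rw [← Real.rpow_neg hδ.1.le]; congr 1; ring
      rw [h3, ← div_eq_mul_inv, le_div_iff₀ (Real.rpow_pos_of_pos hδ.1 _)]
      have h4 := mul_le_mul_of_nonneg_left (h2.trans (le_abs_self C₂)) (zero_le_one.trans hN1)
      linarith [abs_nonneg C₁]

theorem HasGrowth.nonneg {N : ℝ → ℝ} {r : ℝ} (h : HasGrowth N r)
    (hone : ∀ δ, 0 < δ → 1 ≤ N δ) : 0 ≤ r := by
  refine ge_of_tendsto h.tendsto ?_
  filter_upwards [Ioo_mem_nhdsGT one_pos] with δ hδ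
  exact div_nonneg (Real.log_nonneg (hone δ hδ.1))
    (neg_nonneg.2 (Real.log_nonpos hδ.1.le hδ.2.le))

end Growth

/-! ### Compositions along finite words. -/

section WordMaps

variable {I X : Type*}

/-- The composition of the maps of an iterated function system along a finite word. -/
def wordMap (A : I → X → X) : List I → X → X
  | [] => id
  | i :: w => A i ∘ wordMap A w

theorem mapsTo_wordMap {A : I → X → X} {K : Set X} (h : ∀ i, MapsTo (A i) K K) (w : List I) :
    MapsTo (wordMap A w) K K := by
  induction w with
  | nil => exact mapsTo_id K
  | cons i w ih => exact (h i).comp ih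

theorem wordMap_append (A : I → X → X) (u w : List I) :
    wordMap A (u ++ w) = wordMap A u ∘ wordMap A w := by
  induction u with
  | nil => rfl
  | cons i u ih => rw [List.cons_append, wordMap, ih, wordMap]; rfl

theorem CompleteFamily.exists_wordMap_eq {T : Finset (List I)} (hT : CompleteFamily T)
    {A : I → X → X} {K : Set X} (h : ∀ x ∈ K, ∃ i, ∃ y ∈ K, A i y = x) {x : X} (hx : x ∈ K) :
    ∃ w ∈ T, ∃ y ∈ K, wordMap A w y = x := by
  induction hT generalizing x with
  | leaf => exact ⟨[], by simp, x, hx, rfl⟩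
  | node T f _ hT ih =>
    obtain ⟨i, y, hy, rfl⟩ := h x hx
    obtain ⟨u, hu, z, hz, rfl⟩ := ih i hy
    exact ⟨i :: u, (hT _).2 ⟨i, u, hu, rfl⟩, z, hz, rfl⟩

/-- Common initial letters cancel by injectivity; at the first differing letter the two images lie
in disjoint sets `A i '' U` and `A j '' U`. -/
theorem CompleteFamily.disjoint_wordMap {T : Finset (List I)} (hT : CompleteFamily T)
    {A : I → X → X} {U : Set X} (hinj : ∀ i, Function.Injective (A i))
    (hU : ∀ i, MapsTo (A i) U U)
    (hdisj : ∀ i j, i ≠ j → Disjoint (A i '' U) (A j '' U)) {w w' : List I} (hw : w ∈ T)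
    (hw' : w' ∈ T) {x x' : X} (hx : x ∈ U) (hx' : x' ∈ U)
    (h : wordMap A w x = wordMap A w' x') : w = w' := by
  induction hT generalizing w w' with
  | leaf => rw [Finset.mem_singleton.1 hw, Finset.mem_singleton.1 hw']
  | node T f _ hT ih =>
    obtain ⟨i, u, hu, rfl⟩ := (hT _).1 hw
    obtain ⟨j, v, hv, rfl⟩ := (hT _).1 hw'
    have hij : i = j := by
      by_contra hij
      refine Set.disjoint_left.1 (hdisj i j hij) ⟨_, mapsTo_wordMap hU u hx, rfl⟩ ?_
      exact ⟨_, mapsTo_wordMap hU v hx', h.symm⟩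
    subst hij
    rw [ih i hu hv (hinj i h)]

theorem exists_wordMap_eq_affine {f : I → ℝ → ℝ} {a c : I → ℝ} (hf : ∀ i x, f i x = a i * x + c i)
    (w : List I) : ∃ d : ℝ, ∀ x, wordMap f w x = wordProd a w * x + d := by
  induction w with
  | nil => exact ⟨0, fun x => by simp [wordMap]⟩
  | cons i w ih =>
    obtain ⟨d, hd⟩ := ih
    refine ⟨a i * d + c i, fun x => ?_⟩
    rw [wordMap, Function.comp_apply, hd, hf, wordProd_cons]
    ring

end WordMaps

/-! ### Self-similar sets on the line with overlaps. -/

section SelfSimilar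

theorem deltaCoverNumber_ne_top_of_subset_unitInterval {K : Set ℝ} (hK : K ⊆ Icc 0 1) {δ : ℝ}
    (hδ : 0 < δ) : deltaCoverNumber δ K ≠ ⊤ :=
  ne_top_of_le_ne_top (ENat.natCast_ne_top _) (deltaCoverNumber_unitInterval_le hδ hK)

theorem coverCount_unitInterval_le {K : Set ℝ} (hK : K ⊆ Icc 0 1) {δ : ℝ} (hδ : 0 < δ) :
    coverCount K δ ≤ 1 / δ + 1 := by
  refine (coverCount_le_of_le_nat (deltaCoverNumber_unitInterval_le hδ hK)).trans ?_
  push_cast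
  gcongr
  exact Nat.floor_le (by positivity)

variable {I : Type*} [Fintype I] {f : I → ℝ → ℝ} {a c : I → ℝ} {K : Set ℝ} {m : ℝ}

/-- Take a δ-separated set `S` and an η-separated set `R` in `K`, and place a scaled copy of `R`
near every point of `S`, inside a cylinder of ratio between `m * δ / 3` and `δ / 3`. Copies near
different points remain apart and each copy is separated by its ratio times `η`, so overlaps of
cylinders do no harm. -/
theorem deltaCoverNumber_mul_le_of_selfSimilar (hf : ∀ i x, f i x = a i * x + c i)
    (hK : K ⊆ Icc 0 1) (hmaps : ∀ i, MapsTo (f i) K K)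
    (hcov : ∀ x ∈ K, ∃ i, ∃ y ∈ K, f i y = x) (hm : 0 < m) (hma : ∀ i, m ≤ |a i|)
    (ha : ∀ i, |a i| < 1) (hm1 : m ≤ 1) {δ η : ℝ} (hδ : δ ∈ Ioc (0 : ℝ) 1)
    (hη : η ∈ Ioc (0 : ℝ) 1) :
    deltaCoverNumber (2 * δ) K * deltaCoverNumber (2 * η) K ≤
      deltaCoverNumber (m / 3 * δ * η) K := by
  classical
  obtain ⟨S, hS, hSsep, hScard⟩ :=
    exists_separated hδ.1.le (deltaCoverNumber_ne_top_of_subset_unitInterval hK hδ.1)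
  obtain ⟨R, hR, hRsep, hRcard⟩ :=
    exists_separated hη.1.le (deltaCoverNumber_ne_top_of_subset_unitInterval hK hη.1)
  -- With ratio at most `δ / 3`, copies move points of `S` by at most `δ / 3`, which leaves a gap
  -- above `δ / 3` between two copies.
  obtain ⟨T, hT, hTδ⟩ := exists_completeFamily (a := fun i => |a i|) (b := fun i => |a i|) hm hma
    hma ha ha (δ := δ / 3) ⟨by linarith [hδ.1], by linarith [hδ.2]⟩
  have hex : ∀ x ∈ S, ∃ w ∈ T, ∃ y ∈ K, wordMap f w y = x := fun x hx =>
    hT.exists_wordMap_eq hcov (hS hx)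
  choose! w hw y hy hwy using hex
  simp only [min_self, wordProd_abs] at hTδ
  have hdist : ∀ v x x', dist (wordMap f v x) (wordMap f v x') = |wordProd a v| * dist x x' := by
    intro v x x'
    obtain ⟨d, hd⟩ := exists_wordMap_eq_affine hf v
    rw [hd, hd, Real.dist_eq, Real.dist_eq, ← abs_mul]
    congr 1
    ring
  let g : ℝ × ℝ → ℝ := fun p => wordMap f (w p.1) p.2
  have hmδ : 0 < m / 3 * δ * η := mul_pos (mul_pos (by linarith) hδ.1) hη.1
  have hsep : ∀ p ∈ S ×ˢ R, ∀ q ∈ S ×ˢ R, p ≠ q → m / 3 * δ * η < dist (g p) (g q) := by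
    rintro ⟨x, u⟩ hp ⟨x', u'⟩ hq hne
    rw [Finset.mem_product] at hp hq
    rcases eq_or_ne x x' with rfl | hx
    · have hu : u ≠ u' := fun h => hne (by rw [h])
      have h1 := hRsep hp.2 hq.2 hu
      have h2 := (hTδ _ (hw x hp.1)).1
      change _ < dist (wordMap f (w x) u) (wordMap f (w x) u')
      rw [hdist]
      calc m / 3 * δ * η = m * (δ / 3) * η := by ring
        _ < |wordProd a (w x)| * dist u u' := by
          exact mul_lt_mul'' h2 h1 (by nlinarith [hδ.1]) hη.1.le
    · have hclose : ∀ z ∈ S, ∀ v ∈ R, dist (wordMap f (w z) v) z ≤ δ / 3 := by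
        intro z hz v hv
        have h1 := (hTδ _ (hw z hz)).2
        have h2 : dist v (y z) ≤ 1 := by
          exact Real.dist_le_of_mem_Icc_01 (hK (hR hv)) (hK (hy z hz))
        calc dist (wordMap f (w z) v) z = dist (wordMap f (w z) v) (wordMap f (w z) (y z)) := by
              rw [hwy z hz]
          _ = |wordProd a (w z)| * dist v (y z) := hdist _ _ _
          _ ≤ δ / 3 * 1 := mul_le_mul h1 h2 dist_nonneg (by linarith [hδ.1])
          _ = δ / 3 := mul_one _
      have h1 := hSsep hp.1 hq.1 hx
      have h2 := hclose x hp.1 u hp.2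
      have h3 := hclose x' hq.1 u' hq.2
      have h4 : dist x x' ≤ dist (g (x, u)) x + dist (g (x, u)) (g (x', u')) +
          dist (g (x', u')) x' := by
        rw [dist_comm (g (x, u)) x]
        exact dist_triangle4 _ _ _ _
      have h5 : m / 3 * δ * η ≤ δ / 3 := by
        have : m * η ≤ 1 := mul_le_one₀ hm1 hη.1.le hη.2
        nlinarith [hδ.1]
      change dist (g (x, u)) x ≤ _ at h2
      change dist (g (x', u')) x' ≤ _ at h3
      linarith
  have hinj : Set.InjOn g (S ×ˢ R : Finset (ℝ × ℝ)) := by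
    intro p hp q hq h
    by_contra hne
    have := hsep p hp q hq hne
    rw [h, dist_self] at this
    exact absurd this hmδ.le.not_gt
  calc deltaCoverNumber (2 * δ) K * deltaCoverNumber (2 * η) K ≤ S.card * R.card :=
        mul_le_mul' hScard hRcard
    _ = (((S ×ˢ R).image g).card : ℕ∞) := by
        rw [Finset.card_image_of_injOn hinj, Finset.card_product]
        push_cast
        rfl
    _ ≤ deltaCoverNumber (m / 3 * δ * η) K := by
        refine card_le_deltaCoverNumber hmδ.le ?_ ?_
        · intro z hz
          simp only [Finset.coe_image, Set.mem_image, Finset.mem_coe, Finset.mem_product] at hz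
          obtain ⟨p, hp, rfl⟩ := hz
          exact mapsTo_wordMap hmaps _ (hR hp.2)
        · intro z hz z' hz' hne
          simp only [Finset.coe_image, Set.mem_image, Finset.mem_coe] at hz hz'
          obtain ⟨p, hp, rfl⟩ := hz
          obtain ⟨q, hq, rfl⟩ := hz'
          exact hsep p hp q hq fun h => hne (by rw [h])

theorem HasGrowth.of_tendsto_geometric {N : ℝ → ℝ} {c r : ℝ} (hc : c ∈ Ioo (0 : ℝ) 1)
    (hanti : ∀ δ δ', 0 < δ → δ ≤ δ' → N δ' ≤ N δ) (hone : ∀ δ, 0 < δ → 1 ≤ N δ)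
    (h : Tendsto (fun n : ℕ => Real.log (N (c ^ n / c)) / n) atTop (𝓝 (r * -Real.log c))) :
    HasGrowth N r := by
  have hg : 0 < -Real.log c := neg_pos.2 (Real.log_neg hc.1 hc.2)
  set g := -Real.log c with hgdef
  refine HasGrowth.of_antitone hanti hone fun ε hε => ?_
  obtain ⟨n₀, hn₀⟩ := Metric.tendsto_atTop.1 h (ε * g) (by positivity)
  have hM : ∀ n : ℕ, n₀ ≤ n → 0 < n → n * g * (r - ε) ≤ Real.log (N (c ^ n / c)) ∧
      Real.log (N (c ^ n / c)) ≤ n * g * (r + ε) := by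
    intro n hn hn0
    have h1 := hn₀ n hn
    have hn0' : (0 : ℝ) < n := by exact_mod_cast hn0
    rw [Real.dist_eq, abs_lt, lt_sub_iff_add_lt, sub_lt_iff_lt_add, lt_div_iff₀ hn0',
      div_lt_iff₀ hn0'] at h1
    constructor <;> nlinarith
  -- The indices used below, multiplied by `g`, exceed `-log δ` by at most `2 * g`; this constant
  -- absorbs the error.
  refine ⟨c ^ n₀, pow_pos hc.1 _, Real.exp (2 * g * (|r| + ε)), Real.exp_pos _, ?_⟩
  rintro δ ⟨hδ0, hδ1⟩
  have hδ2 : δ ≤ 1 := hδ1.le.trans (pow_le_one₀ hc.1.le hc.2.le)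
  obtain ⟨n, hn1, hn2⟩ := exists_nat_pow_near_of_lt_one hδ0 hδ2 hc.1 hc.2
  have hn : n₀ < n + 1 := (pow_lt_pow_iff_right_of_lt_one₀ hc.1 hc.2).1 (hn1.trans hδ1)
  have e1 : c ^ (n + 1) / c = c ^ n := by rw [pow_succ, mul_div_assoc, div_self hc.1.ne', mul_one]
  have e2 : c ^ (n + 2) / c = c ^ (n + 1) := by
    rw [pow_succ, mul_div_assoc, div_self hc.1.ne', mul_one]
  -- Since the scale of index `n` is `c ^ n / c`, the indices `n + 1` and `n + 2` belong to the
  -- scales `c ^ n` and `c ^ (n + 1)` that bracket `δ`.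
  have hlow := (hM (n + 1) (by omega) (by omega)).1
  have hupp := (hM (n + 2) (by omega) (by omega)).2
  rw [e1] at hlow
  rw [e2] at hupp
  have p0 := pow_pos hc.1 n
  have p1 := pow_pos hc.1 (n + 1)
  have hlow' := hlow.trans (Real.log_le_log (zero_lt_one.trans_le (hone _ p0))
    (hanti _ _ hδ0 hn2))
  have hupp' := (Real.log_le_log (zero_lt_one.trans_le (hone _ hδ0)) (hanti _ _ p1 hn1.le)).trans
    hupp
  have hl1 := Real.log_le_log hδ0 hn2
  have hl2 := Real.log_lt_log p1 hn1
  rw [Real.log_pow] at hl1 hl2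
  push_cast at hl1 hl2 hlow' hupp'
  have hNpos := zero_lt_one.trans_le (hone _ hδ0)
  have hr1 := le_abs_self r
  have hr2 := neg_abs_le r
  have hlc : Real.log c = -g := by rw [hgdef, neg_neg]
  rw [hlc] at hl1 hl2
  constructor
  · rw [← Real.exp_neg, Real.rpow_def_of_pos hδ0, ← Real.exp_add, ← Real.le_log_iff_exp_le hNpos]
    refine le_trans ?_ hlow'
    have hx : 0 ≤ (n + 1) * g + Real.log δ := by linarith
    have hx' : (n + 1) * g + Real.log δ ≤ 2 * g := by linarith
    nlinarith [mul_nonneg hx (by linarith [abs_nonneg r] : 0 ≤ (r - ε) + (|r| + ε)),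
      mul_nonneg (sub_nonneg.2 hx') (by positivity : 0 ≤ |r| + ε)]
  · rw [Real.rpow_def_of_pos hδ0, ← Real.exp_add, ← Real.log_le_iff_le_exp hNpos]
    refine hupp'.trans ?_
    have hx : 0 ≤ (n + 2) * g + Real.log δ := by linarith
    have hx' : (n + 2) * g + Real.log δ ≤ 2 * g := by linarith
    nlinarith [mul_nonneg hx (by linarith [abs_nonneg r] : 0 ≤ (|r| + ε) - (r + ε)),
      mul_nonneg (sub_nonneg.2 hx') (by positivity : 0 ≤ |r| + ε)]

/-- The covering numbers of a self-similar subset of the line, possibly with overlaps, grow like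
a power. -/
theorem exists_hasGrowth_of_selfSimilar [Nonempty I] (hf : ∀ i x, f i x = a i * x + c i)
    (hK : K ⊆ Icc 0 1) (hne : K.Nonempty) (hmaps : ∀ i, MapsTo (f i) K K)
    (hcov : ∀ x ∈ K, ∃ i, ∃ y ∈ K, f i y = x) (hm : 0 < m) (hma : ∀ i, m ≤ |a i|)
    (ha : ∀ i, |a i| < 1) : ∃ r, HasGrowth (coverCount K) r := by
  have hm1 : m < 1 := (hma (Classical.arbitrary I)).trans_lt (ha _)
  have hfin : ∀ δ, 0 < δ → deltaCoverNumber δ K ≠ ⊤ := fun δ hδ =>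
    deltaCoverNumber_ne_top_of_subset_unitInterval hK hδ
  have hone : ∀ δ, 0 < δ → 1 ≤ coverCount K δ := fun δ hδ => one_le_coverCount hne (hfin δ hδ)
  have hanti : ∀ δ δ', 0 < δ → δ ≤ δ' → coverCount K δ' ≤ coverCount K δ := fun δ δ' hδ h =>
    coverCount_le_of_le (hfin δ hδ) (deltaCoverNumber_anti K h)
  -- The factor `m / 3` of the product inequality, times 1/4 for halving both scales.
  set d := m / 12 with hd
  have hd0 : 0 < d := by positivity
  have hd1 : d < 1 / 12 := by linarith
  have hmul : ∀ δ η, δ ∈ Ioc (0 : ℝ) 1 → η ∈ Ioc (0 : ℝ) 1 →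
      coverCount K δ * coverCount K η ≤ coverCount K (d * δ * η) := by
    intro δ η hδ hη
    have h := deltaCoverNumber_mul_le_of_selfSimilar hf hK hmaps hcov hm hma ha hm1.le
      (δ := δ / 2) (η := η / 2) ⟨by linarith [hδ.1], by linarith [hδ.2]⟩
      ⟨by linarith [hη.1], by linarith [hη.2]⟩
    have e : m / 3 * (δ / 2) * (η / 2) = d * δ * η := by rw [hd]; ring
    rw [mul_div_cancel₀ _ two_ne_zero, mul_div_cancel₀ _ two_ne_zero, e] at h
    have h' := ENat.toNat_le_toNat h (hfin _ (mul_pos (mul_pos hd0 hδ.1) hη.1))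
    rw [ENat.toNat_mul] at h'
    unfold coverCount
    exact_mod_cast h'
  have hpos : ∀ n : ℕ, 0 < d ^ n / d := fun n => div_pos (pow_pos hd0 n) hd0
  have hle : ∀ n : ℕ, d ^ (n + 1) / d ≤ 1 := fun n => by
    rw [pow_succ, mul_div_assoc, div_self hd0.ne', mul_one]
    exact pow_le_one₀ hd0.le (by linarith)
  -- At index 0 the scale is `d⁻¹ > 1`, outside the range of `hmul`, but there a single set covers
  -- `K`; so `u 0 = 0` and subadditivity with a zero index is trivial.
  have hzero : coverCount K (d ^ 0 / d) = 1 := by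
    refine le_antisymm ?_ (hone _ (hpos 0))
    have hcov : deltaCoverNumber (d ^ 0 / d) K ≤ (1 : ℕ) := by
      refine (deltaCoverNumber_le_encard (C := {K}) (by simp) ?_).trans (by simp)
      rintro U hU
      rw [mem_singleton_iff] at hU
      subst hU
      refine ediam_le_of_dist_le fun x hx y hy => ?_
      refine (Real.dist_le_of_mem_Icc_01 (hK hx) (hK hy)).trans ?_
      rw [pow_zero, le_div_iff₀ hd0]
      linarith
    simpa using coverCount_le_of_le_nat hcov
  -- Dividing by `d` absorbs the constant in `hmul`: `d * (d ^ p / d) * (d ^ q / d) = d ^ (p + q) /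
  -- d`, so `u` is exactly subadditive.
  set u : ℕ → ℝ := fun n => -Real.log (coverCount K (d ^ n / d)) with hu
  have hu0 : u 0 = 0 := by simp only [hu, hzero, Real.log_one, neg_zero]
  have hsub : Subadditive u := by
    intro p q
    rcases p with _ | p
    · rw [zero_add, hu0, zero_add]
    rcases q with _ | q
    · rw [add_zero, hu0, add_zero]
    have h := hmul _ _ ⟨hpos (p + 1), hle p⟩ ⟨hpos (q + 1), hle q⟩
    have e : d * (d ^ (p + 1) / d) * (d ^ (q + 1) / d) = d ^ (p + 1 + (q + 1)) / d := by
      field_simp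
      ring
    rw [e] at h
    have h1 := zero_lt_one.trans_le (hone _ (hpos (p + 1)))
    have h2 := zero_lt_one.trans_le (hone _ (hpos (q + 1)))
    have h3 := Real.log_le_log (mul_pos h1 h2) h
    rw [Real.log_mul h1.ne' h2.ne'] at h3
    simp only [hu]
    linarith
  have hbdd : BddBelow (range fun n => u n / n) := by
    refine ⟨Real.log d, ?_⟩
    rintro _ ⟨n, rfl⟩
    rcases n with _ | n
    · simp only [Nat.cast_zero, div_zero]
      exact Real.log_nonpos hd0.le (by linarith)
    · have hn : (0 : ℝ) < (n + 1 : ℕ) := by positivity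
      change Real.log d ≤ u (n + 1) / (n + 1 : ℕ)
      rw [le_div_iff₀ hn, mul_comm, ← Real.log_pow]
      simp only [hu]
      rw [← Real.log_inv]
      refine Real.log_le_log (by positivity) ?_
      have h1 := coverCount_unitInterval_le hK (hpos (n + 1))
      have h2 := hle n
      have h3 : coverCount K (d ^ (n + 1) / d) ≤ (d ^ (n + 1))⁻¹ := by
        refine h1.trans ?_
        have h4 : 1 ≤ 1 / (d ^ (n + 1) / d) := by
          rw [le_div_iff₀ (hpos _)]; linarith
        have h5 : 1 / (d ^ (n + 1) / d) = d * (d ^ (n + 1))⁻¹ := by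
          rw [one_div_div]; rfl
        have h6 : 0 < (d ^ (n + 1))⁻¹ := by positivity
        rw [h5] at h4 ⊢
        nlinarith
      rw [le_inv_comm₀ (by positivity) (zero_lt_one.trans_le (hone _ (hpos _)))]
      exact h3
  have hlim := hsub.tendsto_lim hbdd
  have hlogd : Real.log d < 0 := Real.log_neg hd0 (by linarith)
  refine ⟨hsub.lim / Real.log d, HasGrowth.of_tendsto_geometric (c := d) ⟨hd0, by linarith⟩ hanti
    hone ?_⟩
  have := hlim.neg
  rw [mul_neg, div_mul_cancel₀ _ hlogd.ne]
  refine this.congr fun n => ?_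
  simp only [hu]
  rw [neg_div, neg_neg]

end SelfSimilar

/-! ### Diagonal affine maps and covering numbers in the plane. -/

section Plane

theorem abs_sub_le_dist_plane (x y : Plane) (k : Fin 2) : |x k - y k| ≤ dist x y := by
  rw [EuclideanSpace.dist_eq, ← Real.dist_eq]
  refine Real.le_sqrt_of_sq_le ?_
  exact Finset.single_le_sum (f := fun k => dist (x k) (y k) ^ 2) (fun _ _ => sq_nonneg _)
    (Finset.mem_univ k)

theorem dist_plane_le (x y : Plane) : dist x y ≤ |x 0 - y 0| + |x 1 - y 1| := by
  rw [EuclideanSpace.dist_eq, Fin.sum_univ_two, Real.dist_eq, Real.dist_eq]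
  refine Real.sqrt_le_iff.2 ⟨by positivity, ?_⟩
  nlinarith [abs_nonneg (x 0 - y 0), abs_nonneg (x 1 - y 1)]

@[simp] theorem diagAffine_zero (a b : ℝ) (v x : Plane) :
    diagAffine a b v x 0 = a * x 0 + v 0 := rfl

@[simp] theorem diagAffine_one (a b : ℝ) (v x : Plane) :
    diagAffine a b v x 1 = b * x 1 + v 1 := rfl

theorem plane_ext {x y : Plane} (h0 : x 0 = y 0) (h1 : x 1 = y 1) : x = y := by
  ext k
  fin_cases k
  · exact h0
  · exact h1

theorem diagAffine_injective {a b : ℝ} (ha : a ≠ 0) (hb : b ≠ 0) (v : Plane) :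
    Function.Injective (diagAffine a b v) := by
  intro x y h
  have h0 : a * x 0 + v 0 = a * y 0 + v 0 := congrArg (fun z : Plane => z 0) h
  have h1 : b * x 1 + v 1 = b * y 1 + v 1 := congrArg (fun z : Plane => z 1) h
  exact plane_ext (mul_left_cancel₀ ha (add_right_cancel h0))
    (mul_left_cancel₀ hb (add_right_cancel h1))

theorem abs_diagAffine_zero_sub (a b : ℝ) (v x y : Plane) :
    |diagAffine a b v x 0 - diagAffine a b v y 0| = |a| * |x 0 - y 0| := by
  rw [← abs_mul, diagAffine_zero, diagAffine_zero]; congr 1; ring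

theorem abs_diagAffine_one_sub (a b : ℝ) (v x y : Plane) :
    |diagAffine a b v x 1 - diagAffine a b v y 1| = |b| * |x 1 - y 1| := by
  rw [← abs_mul, diagAffine_one, diagAffine_one]; congr 1; ring

theorem abs_sub_le_one_of_mem_unitSquare {x y : Plane} (hx : x ∈ unitSquare)
    (hy : y ∈ unitSquare) (k : Fin 2) : |x k - y k| ≤ 1 := by
  rw [← Real.dist_eq]
  exact Real.dist_le_of_mem_Icc_01 (hx k) (hy k)

theorem exists_wordMap_eq_diagAffine {I : Type*} {A : I → Plane → Plane} {a b : I → ℝ}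
    {v : I → Plane} (hA : ∀ i, A i = diagAffine (a i) (b i) (v i)) (w : List I) :
    ∃ d : Plane, wordMap A w = diagAffine (wordProd a w) (wordProd b w) d := by
  induction w with
  | nil =>
    refine ⟨0, funext fun x => plane_ext ?_ ?_⟩ <;> simp [wordMap]
  | cons i w ih =>
    obtain ⟨d, hd⟩ := ih
    refine ⟨diagAffine (a i) (b i) (v i) d, funext fun x => plane_ext ?_ ?_⟩
    · simp only [wordMap, Function.comp_apply, hd, hA, diagAffine_zero, wordProd_cons]; ring
    · simp only [wordMap, Function.comp_apply, hd, hA, diagAffine_one, wordProd_cons]; ring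

variable {F : Set Plane} {α β δ : ℝ} {d : Plane}

/-- Vertical distances in the image are at most `δ`, so a cover of the projection pulls back; the
horizontal and vertical contributions give `2 * δ`. -/
theorem deltaCoverNumber_diagAffine_image_le_fst (hF : F ⊆ unitSquare) (hα : α ≠ 0) (hδ : 0 < δ)
    (hβ : |β| ≤ δ) :
    deltaCoverNumber (2 * δ) (diagAffine α β d '' F) ≤
      deltaCoverNumber (δ / |α|) ((fun x : Plane => x 0) '' F) := by
  have hα' := abs_pos.2 hα
  refine deltaCoverNumber_le_of_map (by positivity) (fun y : Plane => (y 0 - d 0) / α) ?_ ?_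
  · rintro _ ⟨x, hx, rfl⟩
    refine ⟨x, hx, ?_⟩
    simp only [diagAffine_zero]
    field_simp
    ring
  · rintro _ ⟨x, hx, rfl⟩ _ ⟨y, hy, rfl⟩ h
    simp only [diagAffine_zero, add_sub_cancel_right, mul_div_cancel_left₀ _ hα] at h
    rw [Real.dist_eq, le_div_iff₀ hα'] at h
    refine (dist_plane_le _ _).trans ?_
    rw [abs_diagAffine_zero_sub, abs_diagAffine_one_sub]
    nlinarith [abs_sub_le_one_of_mem_unitSquare (hF hx) (hF hy) 1, abs_nonneg β]

theorem deltaCoverNumber_diagAffine_image_le_snd (hF : F ⊆ unitSquare) (hβ : β ≠ 0) (hδ : 0 < δ)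
    (hα : |α| ≤ δ) :
    deltaCoverNumber (2 * δ) (diagAffine α β d '' F) ≤
      deltaCoverNumber (δ / |β|) ((fun x : Plane => x 1) '' F) := by
  have hβ' := abs_pos.2 hβ
  refine deltaCoverNumber_le_of_map (by positivity) (fun y : Plane => (y 1 - d 1) / β) ?_ ?_
  · rintro _ ⟨x, hx, rfl⟩
    refine ⟨x, hx, ?_⟩
    simp only [diagAffine_one]
    field_simp
    ring
  · rintro _ ⟨x, hx, rfl⟩ _ ⟨y, hy, rfl⟩ h
    simp only [diagAffine_one, add_sub_cancel_right, mul_div_cancel_left₀ _ hβ] at h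
    rw [Real.dist_eq, le_div_iff₀ hβ'] at h
    refine (dist_plane_le _ _).trans ?_
    rw [abs_diagAffine_zero_sub, abs_diagAffine_one_sub]
    nlinarith [abs_sub_le_one_of_mem_unitSquare (hF hx) (hF hy) 0, abs_nonneg α]

/-- A section of the projection carries it into the image, and planar distances dominate horizontal
ones. -/
theorem deltaCoverNumber_fst_le_diagAffine_image (hα : α ≠ 0) (hδ : 0 < δ) :
    deltaCoverNumber (δ / |α|) ((fun x : Plane => x 0) '' F) ≤
      deltaCoverNumber δ (diagAffine α β d '' F) := by
  classical
  have hα' := abs_pos.2 hα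
  have hsec : ∀ p ∈ (fun x : Plane => x 0) '' F, ∃ x ∈ F, x 0 = p := fun p hp => hp
  choose! s hs hs' using hsec
  refine deltaCoverNumber_le_of_map hδ.le (fun p => diagAffine α β d (s p))
    (fun p hp => ⟨_, hs p hp, rfl⟩) fun p hp p' hp' h => ?_
  have := (abs_sub_le_dist_plane _ _ 0).trans h
  rw [abs_diagAffine_zero_sub, hs' p hp, hs' p' hp'] at this
  rw [Real.dist_eq, le_div_iff₀ hα', mul_comm]
  exact this

theorem deltaCoverNumber_snd_le_diagAffine_image (hβ : β ≠ 0) (hδ : 0 < δ) :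
    deltaCoverNumber (δ / |β|) ((fun x : Plane => x 1) '' F) ≤
      deltaCoverNumber δ (diagAffine α β d '' F) := by
  classical
  have hβ' := abs_pos.2 hβ
  have hsec : ∀ p ∈ (fun x : Plane => x 1) '' F, ∃ x ∈ F, x 1 = p := fun p hp => hp
  choose! s hs hs' using hsec
  refine deltaCoverNumber_le_of_map hδ.le (fun p => diagAffine α β d (s p))
    (fun p hp => ⟨_, hs p hp, rfl⟩) fun p hp p' hp' h => ?_
  have := (abs_sub_le_dist_plane _ _ 1).trans h
  rw [abs_diagAffine_one_sub, hs' p hp, hs' p' hp'] at this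
  rw [Real.dist_eq, le_div_iff₀ hβ', mul_comm]
  exact this

theorem deltaCoverNumber_diagAffine_image_ge {m : ℝ} (hm : 0 < m) (hα : m ≤ |α|) (hβ : m ≤ |β|)
    (hδ : 0 < δ) :
    deltaCoverNumber (2 * (δ / m)) F ≤ deltaCoverNumber δ (diagAffine α β d '' F) := by
  refine deltaCoverNumber_le_of_map hδ.le (diagAffine α β d) (mapsTo_image _ _)
    fun x _ y _ h => ?_
  refine (dist_plane_le _ _).trans ?_
  have h0 := (abs_sub_le_dist_plane _ _ 0).trans h
  have h1 := (abs_sub_le_dist_plane _ _ 1).trans h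
  rw [abs_diagAffine_zero_sub] at h0
  rw [abs_diagAffine_one_sub] at h1
  have h0' : |x 0 - y 0| ≤ δ / m := by
    rw [le_div_iff₀ hm]
    nlinarith [abs_nonneg (x 0 - y 0)]
  have h1' : |x 1 - y 1| ≤ δ / m := by
    rw [le_div_iff₀ hm]
    nlinarith [abs_nonneg (x 1 - y 1)]
  linarith

/-- Products of covering sets cover F. Besides finiteness, this yields the bound `t ≤ r₁ + r₂`. -/
theorem deltaCoverNumber_le_mul_projections (hδ : 0 < δ) :
    deltaCoverNumber (2 * δ) F ≤ deltaCoverNumber δ ((fun x : Plane => x 0) '' F) *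
      deltaCoverNumber δ ((fun x : Plane => x 1) '' F) := by
  obtain ⟨C, h1, h2, h3⟩ := exists_cover_encard_eq δ ((fun x : Plane => x 0) '' F)
  obtain ⟨D, h4, h5, h6⟩ := exists_cover_encard_eq δ ((fun x : Plane => x 1) '' F)
  rw [← h3, ← h6, ← Set.encard_prod]
  refine (deltaCoverNumber_le_encard
    (C := (fun P : Set ℝ × Set ℝ => {x : Plane | x 0 ∈ P.1 ∧ x 1 ∈ P.2}) '' C ×ˢ D) ?_ ?_).trans
    (Set.encard_image_le _ _)
  · intro x hx
    obtain ⟨U, hU, hxU⟩ := h1 ⟨x, hx, rfl⟩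
    obtain ⟨V, hV, hxV⟩ := h4 ⟨x, hx, rfl⟩
    exact ⟨_, ⟨(U, V), ⟨hU, hV⟩, rfl⟩, hxU, hxV⟩
  · rintro _ ⟨⟨U, V⟩, ⟨hU, hV⟩, rfl⟩
    refine ediam_le_of_dist_le fun x hx y hy => (dist_plane_le x y).trans ?_
    have h7 := dist_le_of_ediam_le hδ.le (h2 U hU) hx.1 hy.1
    have h8 := dist_le_of_ediam_le hδ.le (h5 V hV) hx.2 hy.2
    rw [Real.dist_eq] at h7 h8
    linarith

/-- An affine image of an open interval which is long compared with the mesh of a lattice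
contains a lattice point close to any given point of its closure. -/
theorem exists_lattice_point {α c p q s u : ℝ} (hs : 0 < s) (hlen : 2 * s < |α| * (q - p))
    (hpq : p < q) (hu : u ∈ Icc p q) :
    ∃ j : ℤ, ∃ u' ∈ Ioo p q, α * u' + c = j * s ∧ |j * s - (α * u + c)| ≤ s := by
  have hα : α ≠ 0 := by
    rintro rfl
    rw [abs_zero, zero_mul] at hlen
    linarith
  have key : ∀ z : ℝ, (p < (z - c) / α ∧ (z - c) / α < q) →
      (z - c) / α ∈ Ioo p q ∧ α * ((z - c) / α) + c = z := fun z hz =>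
    ⟨hz, by rw [mul_div_cancel₀ _ hα]; ring⟩
  set y := α * u + c with hy
  have hfl1 := Int.floor_le (y / s)
  have hfl2 := Int.lt_floor_add_one (y / s)
  have hce1 := Int.le_ceil (y / s)
  have hce2 := Int.ceil_lt_add_one (y / s)
  rw [le_div_iff₀ hs] at hfl1
  rw [div_lt_iff₀ hs] at hfl2
  rw [div_le_iff₀ hs] at hce1
  have hce3 : (⌈y / s⌉ : ℝ) * s < y + s := by
    have := mul_lt_mul_of_pos_right hce2 hs
    rwa [add_mul, div_mul_cancel₀ _ hs.ne', one_mul] at this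
  -- Use the lattice point strictly above `y` if there is room below `Q`, otherwise the one strictly
  -- below `y`: an interval longer than `2 * s` has room on one side.
  have hup : ∀ P Q : ℝ, P ≤ y → y ≤ Q → P + 2 * s < Q →
      ∃ j : ℤ, P < j * s ∧ j * s < Q ∧ |j * s - y| ≤ s := by
    intro P Q hP hQ hPQ
    rcases lt_or_ge (y + s) Q with h | h
    · refine ⟨⌊y / s⌋ + 1, ?_, ?_, ?_⟩
      · push_cast; linarith
      · push_cast; linarith
      · push_cast
        rw [abs_le]
        constructor <;> linarith
    · refine ⟨⌈y / s⌉ - 1, ?_, ?_, ?_⟩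
      · push_cast; linarith
      · push_cast; linarith
      · push_cast
        rw [abs_le]
        constructor <;> linarith
  rcases lt_or_gt_of_ne hα with hneg | hpos
  · rw [abs_of_neg hneg] at hlen
    obtain ⟨j, h1, h2, h3⟩ := hup (α * q + c) (α * p + c) (by nlinarith [hu.2])
      (by nlinarith [hu.1]) (by nlinarith)
    have hmem := key (j * s) ⟨by rw [lt_div_iff_of_neg hneg]; linarith,
      by rw [div_lt_iff_of_neg hneg]; linarith⟩
    exact ⟨j, _, hmem.1, hmem.2, h3⟩
  · rw [abs_of_pos hpos] at hlen
    obtain ⟨j, h1, h2, h3⟩ := hup (α * p + c) (α * q + c) (by nlinarith [hu.1])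
      (by nlinarith [hu.2]) (by nlinarith)
    have hmem := key (j * s) ⟨by rw [lt_div_iff₀ hpos]; linarith,
      by rw [div_lt_iff₀ hpos]; linarith⟩
    exact ⟨j, _, hmem.1, hmem.2, h3⟩

end Plane

/-! ### Counting cylinders under the rectangular open set condition. -/

section RectangularOSC

variable {I : Type*} {A : I → Plane → Plane} {a b : I → ℝ} {v : I → Plane} {F : Set Plane}

/-- A set of diameter `δ` meets boundedly many cylinders of a complete family at scale `δ`. -/
theorem exists_card_meeting_le (hA : ∀ i, A i = diagAffine (a i) (b i) (v i))
    (ha : ∀ i, a i ≠ 0) (hb : ∀ i, b i ≠ 0) {p q : Fin 2 → ℝ} (hpq : ∀ k, p k < q k)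
    (hU : ∀ i, MapsTo (A i) (openRect p q) (openRect p q))
    (hdisj : ∀ i j, i ≠ j → Disjoint (A i '' openRect p q) (A j '' openRect p q))
    (hF : ∀ x ∈ F, ∀ k, x k ∈ Icc (p k) (q k)) {m : ℝ} (hm : 0 < m) :
    ∃ C : ℕ, ∀ δ : ℝ, 0 < δ → ∀ T : Finset (List I), CompleteFamily T →
      (∀ w ∈ T, m * δ < |wordProd a w| ∧ m * δ < |wordProd b w|) →
      ∀ V : Set Plane, Metric.ediam V ≤ ENNReal.ofReal δ → ∀ R ⊆ T,
        (∀ w ∈ R, (wordMap A w '' F ∩ V).Nonempty) → R.card ≤ C := by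
  classical
  obtain ⟨l, hl, hl0, hl1⟩ : ∃ l : ℝ, 0 < l ∧ l ≤ q 0 - p 0 ∧ l ≤ q 1 - p 1 :=
    ⟨min (q 0 - p 0) (q 1 - p 1), lt_min (sub_pos.2 (hpq 0)) (sub_pos.2 (hpq 1)),
      min_le_left _ _, min_le_right _ _⟩
  -- In units of the mesh `s`, the chosen lattice points are within `(s + δ) / s = 1 + 4 / (l * m)`
  -- of `z`; rounding `z` to the lattice costs 1 more.
  obtain ⟨M, hM⟩ := exists_nat_ge (2 + 4 / (l * m))
  refine ⟨(Finset.Icc (-M : ℤ) M ×ˢ Finset.Icc (-M : ℤ) M).card, ?_⟩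
  intro δ hδ T hT hTδ V hV R hRT hR
  rcases R.eq_empty_or_nonempty with rfl | ⟨w₀, hw₀⟩
  · simp
  obtain ⟨z, -, hz⟩ := hR w₀ hw₀
  -- The images of the open rectangle have sides longer than `l * m * δ = 4 * s`, enough for
  -- `exists_lattice_point`.
  set s := l * m * δ / 4 with hs
  have hs0 : 0 < s := by positivity
  have hslen : ∀ α l', l ≤ l' → m * δ < |α| → 2 * s < |α| * l' := by
    intro α l' hll hα
    have : 0 < m * δ := by positivity
    have h1 : m * δ * l < |α| * l' := by nlinarith
    rw [hs]
    nlinarith [mul_pos this hl]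
  have hclose : ∀ (k : Fin 2) (y : Plane) (j : ℤ), y ∈ V → |j * s - y k| ≤ s →
      j - ⌊z k / s⌋ ∈ Finset.Icc (-M : ℤ) M := by
    intro k y j hy hj
    have h1 := (abs_sub_le_dist_plane y z k).trans (dist_le_of_ediam_le hδ.le hV hy hz)
    have hfl1 := Int.floor_le (z k / s)
    have hfl2 := Int.lt_floor_add_one (z k / s)
    have hdiv : δ / s = 4 / (l * m) := by rw [hs]; field_simp
    have h2 : |(j : ℝ) - z k / s| ≤ 1 + 4 / (l * m) := by
      have e : (j : ℝ) - z k / s = (j * s - z k) / s := by field_simp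
      rw [e, abs_div, abs_of_pos hs0, ← hdiv, div_le_iff₀ hs0, add_mul, div_mul_cancel₀ _ hs0.ne',
        one_mul]
      calc |j * s - z k| = |(j * s - y k) + (y k - z k)| := by congr 1; ring
        _ ≤ s + δ := (abs_add_le _ _).trans (add_le_add hj h1)
    rw [abs_le] at h2
    rw [Finset.mem_Icc]
    constructor
    · have : (-(M : ℤ) : ℝ) ≤ ((j - ⌊z k / s⌋ : ℤ) : ℝ) := by push_cast; linarith
      exact_mod_cast this
    · have : ((j - ⌊z k / s⌋ : ℤ) : ℝ) ≤ (M : ℤ) := by push_cast; linarith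
      exact_mod_cast this
  -- Each cylinder meeting `V` receives a lattice point of its own open rectangle. These rectangles
  -- are disjoint, so the points are distinct, and only boundedly many lie near `z`.
  have hex : ∀ w ∈ R, ∃ j : ℤ × ℤ, (j.1 - ⌊z 0 / s⌋ ∈ Finset.Icc (-M : ℤ) M ∧
      j.2 - ⌊z 1 / s⌋ ∈ Finset.Icc (-M : ℤ) M) ∧
      ∃ u ∈ openRect p q, wordMap A w u = !₂[j.1 * s, j.2 * s] := by
    intro w hw
    obtain ⟨_, ⟨x, hx, rfl⟩, hxV⟩ := hR w hw
    obtain ⟨d, hd⟩ := exists_wordMap_eq_diagAffine hA w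
    obtain ⟨h1, h2⟩ := hTδ w (hRT hw)
    obtain ⟨j, u, hu, hju, hj⟩ := exists_lattice_point (c := d 0) hs0 (hslen _ _ hl0 h1) (hpq 0)
      (hF x hx 0)
    obtain ⟨j', u', hu', hju', hj'⟩ := exists_lattice_point (c := d 1) hs0 (hslen _ _ hl1 h2)
      (hpq 1) (hF x hx 1)
    rw [hd] at hxV
    refine ⟨(j, j'), ⟨hclose 0 _ j hxV hj, hclose 1 _ j' hxV hj'⟩, !₂[u, u'], ?_, ?_⟩
    · intro k
      fin_cases k
      · exact hu
      · exact hu'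
    · rw [hd]
      exact plane_ext hju hju'
  choose! j hj u hu hju using hex
  refine Finset.card_le_card_of_injOn (fun w => ((j w).1 - ⌊z 0 / s⌋, (j w).2 - ⌊z 1 / s⌋)) ?_ ?_
  · intro w hw
    exact Finset.mem_product.2 (hj w hw)
  · intro w hw w' hw' h
    have h1 := (Prod.mk.inj h).1
    have h2 := (Prod.mk.inj h).2
    have e : j w = j w' := Prod.ext (sub_left_injective h1) (sub_left_injective h2)
    refine hT.disjoint_wordMap (fun i => ?_) hU hdisj (hRT hw) (hRT hw') (hu w hw) (hu w' hw') ?_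
    · rw [hA]; exact diagAffine_injective (ha i) (hb i) _
    · rw [hju w hw, hju w' hw', e]

/-- Double counting: the members of an optimal cover of F that meet a cylinder cover it, and each
member meets at most `C` cylinders. -/
theorem sum_deltaCoverNumber_cylinders_le {δ : ℝ} {T : Finset (List I)} {C : ℕ}
    (hmaps : ∀ i, MapsTo (A i) F F) (hfin : deltaCoverNumber δ F ≠ ⊤)
    (hC : ∀ V : Set Plane, Metric.ediam V ≤ ENNReal.ofReal δ → ∀ R ⊆ T,
        (∀ w ∈ R, (wordMap A w '' F ∩ V).Nonempty) → R.card ≤ C) :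
    ∑ w ∈ T, coverCount (wordMap A w '' F) δ ≤ C * coverCount F δ := by
  classical
  obtain ⟨𝒱, h1, h2, h3⟩ := exists_finite_cover hfin
  have hsub : ∀ w ∈ T, coverCount (wordMap A w '' F) δ ≤
      ((𝒱.filter fun V => (wordMap A w '' F ∩ V).Nonempty).card : ℝ) := by
    intro w _
    refine coverCount_le_of_le_nat ?_
    rw [← Set.encard_coe_eq_coe_finsetCard]
    refine deltaCoverNumber_le_encard ?_ fun U hU => h2 U (Finset.mem_filter.1 hU).1
    intro x hx
    have hxF : x ∈ F := by
      obtain ⟨y, hy, rfl⟩ := hx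
      exact mapsTo_wordMap hmaps w hy
    obtain ⟨V, hV, hxV⟩ := h1 hxF
    exact ⟨V, Finset.mem_coe.2 (Finset.mem_filter.2 ⟨hV, x, hx, hxV⟩), hxV⟩
  have hcard : coverCount F δ = 𝒱.card := by
    rw [coverCount, ← h3, ENat.toNat_natCast]
  refine (Finset.sum_le_sum hsub).trans ?_
  rw [hcard]
  have hdc := Finset.sum_card_bipartiteAbove_eq_sum_card_bipartiteBelow (s := T) (t := 𝒱)
    (fun w V => (wordMap A w '' F ∩ V).Nonempty)
  unfold Finset.bipartiteAbove Finset.bipartiteBelow at hdc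
  have hle : ∑ w ∈ T, (𝒱.filter fun V => (wordMap A w '' F ∩ V).Nonempty).card ≤ C * 𝒱.card := by
    rw [hdc, mul_comm, ← smul_eq_mul]
    refine Finset.sum_le_card_nsmul _ _ _ fun V hV => ?_
    exact hC V (h2 V hV) _ (Finset.filter_subset _ _) fun w hw => (Finset.mem_filter.1 hw).2
  exact_mod_cast hle

end RectangularOSC

/-! ### Slice estimates and the equation for t. -/

section Exponents

theorem rpow_le_rpow_neg_abs {m c : ℝ} (hm : 0 < m) (hmc : m ≤ c) (hc : c ≤ 1) (x : ℝ) :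
    c ^ x ≤ m ^ (-|x|) :=
  (Real.rpow_le_rpow_of_exponent_ge (hm.trans_le hmc) hc (neg_abs_le x)).trans
    (Real.rpow_le_rpow_of_nonpos hm hmc (neg_nonpos.2 (abs_nonneg x)))

theorem rpow_le_of_comparable {m δ β : ℝ} (hm : 0 < m) (hδ : 0 < δ) (h1 : m * δ ≤ β) (h2 : β ≤ δ)
    (x : ℝ) : δ ^ x ≤ m ^ (-|x|) * β ^ x ∧ m ^ |x| * β ^ x ≤ δ ^ x := by
  have hβ : 0 < β := (mul_pos hm hδ).trans_le h1
  have hc1 : m ≤ β / δ := (le_div_iff₀ hδ).2 h1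
  have hc2 : β / δ ≤ 1 := (div_le_one hδ).2 h2
  have hβx := Real.rpow_pos_of_pos hβ x
  have hδx := Real.rpow_pos_of_pos hδ x
  constructor
  · have h := rpow_le_rpow_neg_abs hm hc1 hc2 (-x)
    rw [abs_neg, Real.rpow_neg (by positivity), Real.div_rpow hβ.le hδ.le, inv_div,
      div_le_iff₀ hβx] at h
    exact h
  · have h := rpow_le_rpow_neg_abs hm hc1 hc2 x
    rw [Real.rpow_neg hm.le, Real.div_rpow hβ.le hδ.le, div_le_iff₀ hδx, inv_mul_eq_div,
      le_div_iff₀ (Real.rpow_pos_of_pos hm _)] at h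
    linarith

/-- Up to ε, `(δ / α) ^ (-r) = δ ^ (-s) * α ^ r * δ ^ (s - r)`, and `δ ^ (s - r)` is comparable to
`β ^ (s - r)` because `m * δ < β ≤ δ`. As `β ≤ α`, the argument stays below `1 / m`. -/
theorem HasGrowth.slice_le {N : ℝ → ℝ} {r : ℝ} (h : HasGrowth N r) {m : ℝ} (hm : 0 < m) (s : ℝ)
    {ε : ℝ} (hε : 0 < ε) : ∃ C > 0, ∀ δ α β : ℝ, 0 < δ → m * δ < β → β ≤ δ → β ≤ α → α ≤ 1 →
      N (δ / α) ≤ C * δ ^ (-s - ε) * (α ^ r * β ^ (s - r)) := by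
  obtain ⟨C, hC, hN⟩ := h ε hε (1 / m) (by positivity)
  refine ⟨C * m ^ (-|s - r|), mul_pos hC (Real.rpow_pos_of_pos hm _), ?_⟩
  intro δ α β hδ h1 h2 h3 h4
  have hβ : 0 < β := (mul_pos hm hδ).trans h1
  have hα : 0 < α := hβ.trans_le h3
  have hlt : δ / α < 1 / m := by
    rw [div_lt_div_iff₀ hα hm]; nlinarith
  refine (hN _ ⟨div_pos hδ hα, hlt⟩).2.trans ?_
  have e1 : (δ / α) ^ (-r - ε) = δ ^ (-s - ε) * δ ^ (s - r) * (α ^ r * α ^ ε) := by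
    rw [Real.div_rpow hδ.le hα.le, ← Real.rpow_add hδ, ← Real.rpow_add hα, div_eq_mul_inv,
      ← Real.rpow_neg hα.le]
    congr 2 <;> ring
  have e2 := (rpow_le_of_comparable hm hδ h1.le h2 (s - r)).1
  have e3 : α ^ ε ≤ 1 := Real.rpow_le_one hα.le h4 hε.le
  rw [e1]
  calc C * (δ ^ (-s - ε) * δ ^ (s - r) * (α ^ r * α ^ ε))
      ≤ C * (δ ^ (-s - ε) * (m ^ (-|s - r|) * β ^ (s - r)) * (α ^ r * 1)) := by gcongr
    _ = _ := by ring

theorem HasGrowth.slice_ge {N : ℝ → ℝ} {r : ℝ} (h : HasGrowth N r) {m : ℝ} (hm : 0 < m) (s : ℝ)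
    {ε : ℝ} (hε : 0 < ε) : ∃ C > 0, ∀ δ α β : ℝ, 0 < δ → m * δ < β → β ≤ δ → β ≤ α → α ≤ 1 →
      C * δ ^ (-s + ε) * (α ^ r * β ^ (s - r)) ≤ N (δ / α) := by
  obtain ⟨C, hC, hN⟩ := h ε hε (1 / m) (by positivity)
  refine ⟨C⁻¹ * m ^ |s - r|, mul_pos (inv_pos.2 hC) (Real.rpow_pos_of_pos hm _), ?_⟩
  intro δ α β hδ h1 h2 h3 h4
  have hβ : 0 < β := (mul_pos hm hδ).trans h1
  have hα : 0 < α := hβ.trans_le h3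
  have hlt : δ / α < 1 / m := by
    rw [div_lt_div_iff₀ hα hm]; nlinarith
  refine le_trans ?_ (hN _ ⟨div_pos hδ hα, hlt⟩).1
  have e1 : (δ / α) ^ (-r + ε) = δ ^ (-s + ε) * δ ^ (s - r) * (α ^ r * α ^ (-ε)) := by
    rw [Real.div_rpow hδ.le hα.le, ← Real.rpow_add hδ, ← Real.rpow_add hα, div_eq_mul_inv,
      ← Real.rpow_neg hα.le]
    congr 2 <;> ring
  have e2 := (rpow_le_of_comparable hm hδ h1.le h2 (s - r)).2
  have e3 : 1 ≤ α ^ (-ε) := Real.one_le_rpow_of_pos_of_le_one_of_nonpos hα h4 (by linarith)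
  rw [e1]
  calc C⁻¹ * m ^ |s - r| * δ ^ (-s + ε) * (α ^ r * β ^ (s - r))
      = C⁻¹ * (δ ^ (-s + ε) * (m ^ |s - r| * β ^ (s - r)) * (α ^ r * 1)) := by ring
    _ ≤ _ := by gcongr

/-- The quotient of the two sides is `(β / α) ^ (r₁ + r₂ - s)`. Thus the weight of the longer
direction dominates the other one. -/
theorem rpow_mul_rpow_le_swap {α β r₁ r₂ s : ℝ} (hβ : 0 < β) (h : β ≤ α) (hs : s ≤ r₁ + r₂) :
    β ^ r₂ * α ^ (s - r₂) ≤ α ^ r₁ * β ^ (s - r₁) := by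
  have hα := hβ.trans_le h
  have e1 : β ^ r₂ = β ^ (s - r₁) * β ^ (r₁ + r₂ - s) := by
    rw [← Real.rpow_add hβ]; congr 1; ring
  have e2 : α ^ r₁ = α ^ (r₁ + r₂ - s) * α ^ (s - r₂) := by
    rw [← Real.rpow_add hα]; congr 1; ring
  rw [e1, e2]
  have h3 : β ^ (r₁ + r₂ - s) ≤ α ^ (r₁ + r₂ - s) := Real.rpow_le_rpow hβ.le h (by linarith)
  calc β ^ (s - r₁) * β ^ (r₁ + r₂ - s) * α ^ (s - r₂)
      ≤ β ^ (s - r₁) * α ^ (r₁ + r₂ - s) * α ^ (s - r₂) := by gcongr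
    _ = _ := by ring

variable {I : Type*} [Fintype I]

theorem sum_rpow_strictAnti [Nonempty I] {a b : I → ℝ} (ha : ∀ i, a i ∈ Ioo (0 : ℝ) 1)
    (hb : ∀ i, b i ∈ Ioo (0 : ℝ) 1) (r : ℝ) :
    StrictAnti fun s : ℝ => ∑ i, a i ^ r * b i ^ (s - r) := by
  intro s t hst
  refine Finset.sum_lt_sum_of_nonempty Finset.univ_nonempty fun i _ => ?_
  exact mul_lt_mul_of_pos_left
    (Real.rpow_lt_rpow_of_exponent_gt (hb i).1 (hb i).2 (by linarith))
    (Real.rpow_pos_of_pos (ha i).1 _)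

theorem continuous_sum_rpow {a b : I → ℝ} (hb : ∀ i, b i ∈ Ioo (0 : ℝ) 1) (r : ℝ) :
    Continuous fun s : ℝ => ∑ i, a i ^ r * b i ^ (s - r) := by
  refine continuous_finsetSum _ fun i _ => continuous_const.mul ?_
  exact (Real.continuous_const_rpow (hb i).1.ne').comp (continuous_sub_right r)

theorem tendsto_sum_rpow {a b : I → ℝ} (hb : ∀ i, b i ∈ Ioo (0 : ℝ) 1) (r : ℝ) :
    Tendsto (fun s : ℝ => ∑ i, a i ^ r * b i ^ (s - r)) atTop (𝓝 0) := by
  have : Tendsto (fun s : ℝ => ∑ i, a i ^ r * b i ^ (s - r)) atTop (𝓝 (∑ i : I, a i ^ r * 0)) := by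
    refine tendsto_finsetSum _ fun i _ => Tendsto.const_mul _ ?_
    exact (tendsto_rpow_atTop_of_base_lt_one (b i) (by linarith [(hb i).1]) (hb i).2).comp
      (tendsto_atTop_add_const_right _ (-r) tendsto_id)
  simpa using this

theorem one_lt_sum_of_one_le [Nontrivial I] {x : I → ℝ} (hx : ∀ i, 0 < x i) {j : I}
    (hj : 1 ≤ x j) : 1 < ∑ i, x i := by
  obtain ⟨k, hk⟩ := exists_ne j
  refine hj.trans_lt ?_
  exact Finset.single_lt_sum hk (Finset.mem_univ j) (Finset.mem_univ k) (hx k) fun i _ _ =>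
    (hx i).le

/-- At exponent 0, a letter contributes at least 1 to the sum belonging to its longer side, and a
second letter makes the inequality strict. This forces `t > 0`. -/
theorem one_lt_max_sum_rpow [Nontrivial I] {a b : I → ℝ} (ha : ∀ i, a i ∈ Ioo (0 : ℝ) 1)
    (hb : ∀ i, b i ∈ Ioo (0 : ℝ) 1) {r₁ r₂ : ℝ} (hr₁ : 0 ≤ r₁) (hr₂ : 0 ≤ r₂) :
    1 < max (∑ i, a i ^ r₁ * b i ^ (0 - r₁)) (∑ i, b i ^ r₂ * a i ^ (0 - r₂)) := by
  have key : ∀ x y r : ℝ, 0 < y → y ≤ x → 0 ≤ r → 1 ≤ x ^ r * y ^ (0 - r) := by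
    intro x y r hy hyx hr
    rw [zero_sub, Real.rpow_neg hy.le, ← div_eq_mul_inv, one_le_div (Real.rpow_pos_of_pos hy _)]
    exact Real.rpow_le_rpow hy.le hyx hr
  obtain ⟨j, -⟩ := exists_pair_ne I
  rcases le_total (b j) (a j) with h | h
  · refine lt_max_of_lt_left (one_lt_sum_of_one_le (fun i => ?_) (key _ _ _ (hb j).1 h hr₁))
    exact mul_pos (Real.rpow_pos_of_pos (ha i).1 _) (Real.rpow_pos_of_pos (hb i).1 _)
  · refine lt_max_of_lt_right (one_lt_sum_of_one_le (fun i => ?_) (key _ _ _ (ha j).1 h hr₂))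
    exact mul_pos (Real.rpow_pos_of_pos (hb i).1 _) (Real.rpow_pos_of_pos (ha i).1 _)

theorem max_sum_rpow_strictAnti [Nonempty I] {a b : I → ℝ} (ha : ∀ i, a i ∈ Ioo (0 : ℝ) 1)
    (hb : ∀ i, b i ∈ Ioo (0 : ℝ) 1) (r₁ r₂ : ℝ) :
    StrictAnti fun s : ℝ =>
      max (∑ i, a i ^ r₁ * b i ^ (s - r₁)) (∑ i, b i ^ r₂ * a i ^ (s - r₂)) := fun _ _ h =>
  max_lt_max (sum_rpow_strictAnti ha hb r₁ h) (sum_rpow_strictAnti hb ha r₂ h)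

theorem exists_max_sum_rpow_eq_one [Nontrivial I] {a b : I → ℝ} (ha : ∀ i, a i ∈ Ioo (0 : ℝ) 1)
    (hb : ∀ i, b i ∈ Ioo (0 : ℝ) 1) {r₁ r₂ : ℝ} (hr₁ : 0 ≤ r₁) (hr₂ : 0 ≤ r₂) :
    ∃ t : ℝ, 0 < t ∧
      max (∑ i, a i ^ r₁ * b i ^ (t - r₁)) (∑ i, b i ^ r₂ * a i ^ (t - r₂)) = 1 := by
  have hlim := (tendsto_sum_rpow (a := a) hb r₁).max (tendsto_sum_rpow (a := b) ha r₂)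
  rw [max_self] at hlim
  obtain ⟨R, hR, hR0⟩ := ((hlim.eventually_lt_const one_pos).and (eventually_ge_atTop 0)).exists
  have hcont := (continuous_sum_rpow (a := a) hb r₁).max (continuous_sum_rpow (a := b) ha r₂)
  obtain ⟨t, ht, ht1⟩ := intermediate_value_Icc' hR0 hcont.continuousOn
    ⟨hR.le, (one_lt_max_sum_rpow ha hb hr₁ hr₂).le⟩
  refine ⟨t, lt_of_le_of_ne ht.1 ?_, ht1⟩
  rintro rfl
  exact (one_lt_max_sum_rpow ha hb hr₁ hr₂).ne' ht1

end Exponents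

/-! ### From slice counts to the growth of the covering numbers. -/

section Slices

variable {I : Type*}

/-- The covering number of a projection of the limit set which approximates the covering number
at scale `δ` of the cylinder of the word `w`: the projection along the shorter side is used. -/
noncomputable def sliceCount (N₁ N₂ : ℝ → ℝ) (a b : I → ℝ) (δ : ℝ) (w : List I) : ℝ :=
  if wordProd b w ≤ wordProd a w then N₁ (δ / wordProd a w) else N₂ (δ / wordProd b w)

/-- The word `w` belongs to the scale `δ`. -/
def AtScale (a b : I → ℝ) (m δ : ℝ) (w : List I) : Prop :=
  m * δ < min (wordProd a w) (wordProd b w) ∧ min (wordProd a w) (wordProd b w) ≤ δ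

variable {N₁ N₂ NF : ℝ → ℝ} {a b : I → ℝ} {m r₁ r₂ : ℝ}

/-- Which side is longer depends on the word, so the bound carries the sum of both weights; nothing
is lost since both total at most 1. -/
theorem sliceCount_le (ha : ∀ i, a i ∈ Ioo (0 : ℝ) 1) (hb : ∀ i, b i ∈ Ioo (0 : ℝ) 1)
    (hm : 0 < m) (h₁ : HasGrowth N₁ r₁) (h₂ : HasGrowth N₂ r₂) (s : ℝ) {ε : ℝ} (hε : 0 < ε) :
    ∃ C > 0, ∀ δ, 0 < δ → ∀ w, AtScale a b m δ w →
      sliceCount N₁ N₂ a b δ w ≤ C * δ ^ (-s - ε) *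
        (wordProd (fun i => a i ^ r₁ * b i ^ (s - r₁)) w +
          wordProd (fun i => b i ^ r₂ * a i ^ (s - r₂)) w) := by
  obtain ⟨C, hC, h⟩ := h₁.slice_le hm s hε
  obtain ⟨D, hD, h'⟩ := h₂.slice_le hm s hε
  refine ⟨C + D, by positivity, fun δ hδ w hw => ?_⟩
  have pa := wordProd_pos (fun i => (ha i).1) w
  have pb := wordProd_pos (fun i => (hb i).1) w
  have qa := wordProd_le_one (fun i => (ha i).1) (fun i => (ha i).2.le) w
  have qb := wordProd_le_one (fun i => (hb i).1) (fun i => (hb i).2.le) w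
  rw [wordProd_rpow_mul_rpow (fun i => (ha i).1) (fun i => (hb i).1),
    wordProd_rpow_mul_rpow (fun i => (hb i).1) (fun i => (ha i).1)]
  set α := wordProd a w
  set β := wordProd b w
  have e1 : 0 < δ ^ (-s - ε) := Real.rpow_pos_of_pos hδ _
  have e2 : 0 < α ^ r₁ * β ^ (s - r₁) :=
    mul_pos (Real.rpow_pos_of_pos pa _) (Real.rpow_pos_of_pos pb _)
  have e3 : 0 < β ^ r₂ * α ^ (s - r₂) :=
    mul_pos (Real.rpow_pos_of_pos pb _) (Real.rpow_pos_of_pos pa _)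
  obtain ⟨hw1, hw2⟩ := hw
  unfold sliceCount
  split_ifs with hle
  · change β ≤ α at hle
    rw [min_eq_right hle] at hw1 hw2
    refine (h δ α β hδ hw1 hw2 hle qa).trans ?_
    have : (C + D) * δ ^ (-s - ε) * (α ^ r₁ * β ^ (s - r₁) + β ^ r₂ * α ^ (s - r₂)) =
      C * δ ^ (-s - ε) * (α ^ r₁ * β ^ (s - r₁)) + D * δ ^ (-s - ε) * (α ^ r₁ * β ^ (s - r₁)) +
      (C + D) * δ ^ (-s - ε) * (β ^ r₂ * α ^ (s - r₂)) := by ring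
    rw [this, add_assoc]
    exact le_add_of_nonneg_right (by positivity)
  · change ¬ β ≤ α at hle
    have hle := (not_le.1 hle).le
    rw [min_eq_left hle] at hw1 hw2
    refine (h' δ β α hδ hw1 hw2 hle qb).trans ?_
    have : (C + D) * δ ^ (-s - ε) * (α ^ r₁ * β ^ (s - r₁) + β ^ r₂ * α ^ (s - r₂)) =
      D * δ ^ (-s - ε) * (β ^ r₂ * α ^ (s - r₂)) + (C * δ ^ (-s - ε) * (β ^ r₂ * α ^ (s - r₂)) +
      (C + D) * δ ^ (-s - ε) * (α ^ r₁ * β ^ (s - r₁))) := by ring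
    rw [this]
    exact le_add_of_nonneg_right (by positivity)

theorem le_sliceCount (ha : ∀ i, a i ∈ Ioo (0 : ℝ) 1) (hb : ∀ i, b i ∈ Ioo (0 : ℝ) 1)
    (hm : 0 < m) (h₁ : HasGrowth N₁ r₁) (h₂ : HasGrowth N₂ r₂) {s : ℝ} (hs : s ≤ r₁ + r₂) {ε : ℝ}
    (hε : 0 < ε) :
    ∃ C > 0, ∀ δ, 0 < δ → ∀ w, AtScale a b m δ w →
      C * δ ^ (-s + ε) * wordProd (fun i => a i ^ r₁ * b i ^ (s - r₁)) w ≤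
        sliceCount N₁ N₂ a b δ w ∧
      C * δ ^ (-s + ε) * wordProd (fun i => b i ^ r₂ * a i ^ (s - r₂)) w ≤
        sliceCount N₁ N₂ a b δ w := by
  obtain ⟨C, hC, h⟩ := h₁.slice_ge hm s hε
  obtain ⟨D, hD, h'⟩ := h₂.slice_ge hm s hε
  refine ⟨min C D, lt_min hC hD, fun δ hδ w hw => ?_⟩
  have pa := wordProd_pos (fun i => (ha i).1) w
  have pb := wordProd_pos (fun i => (hb i).1) w
  have qa := wordProd_le_one (fun i => (ha i).1) (fun i => (ha i).2.le) w
  have qb := wordProd_le_one (fun i => (hb i).1) (fun i => (hb i).2.le) w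
  rw [wordProd_rpow_mul_rpow (fun i => (ha i).1) (fun i => (hb i).1),
    wordProd_rpow_mul_rpow (fun i => (hb i).1) (fun i => (ha i).1)]
  set α := wordProd a w
  set β := wordProd b w
  have e1 : 0 < δ ^ (-s + ε) := Real.rpow_pos_of_pos hδ _
  have e2 : 0 < α ^ r₁ * β ^ (s - r₁) :=
    mul_pos (Real.rpow_pos_of_pos pa _) (Real.rpow_pos_of_pos pb _)
  have e3 : 0 < β ^ r₂ * α ^ (s - r₂) :=
    mul_pos (Real.rpow_pos_of_pos pb _) (Real.rpow_pos_of_pos pa _)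
  have e4 : 0 < min C D := lt_min hC hD
  obtain ⟨hw1, hw2⟩ := hw
  unfold sliceCount
  split_ifs with hle
  · change β ≤ α at hle
    rw [min_eq_right hle] at hw1 hw2
    have hmain : min C D * δ ^ (-s + ε) * (α ^ r₁ * β ^ (s - r₁)) ≤ N₁ (δ / α) := by
      refine le_trans ?_ (h δ α β hδ hw1 hw2 hle qa)
      gcongr
      exact min_le_left _ _
    refine ⟨hmain, le_trans ?_ hmain⟩
    exact mul_le_mul_of_nonneg_left (rpow_mul_rpow_le_swap pb hle hs) (by positivity)
  · change ¬ β ≤ α at hle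
    have hle := (not_le.1 hle).le
    rw [min_eq_left hle] at hw1 hw2
    have hmain : min C D * δ ^ (-s + ε) * (β ^ r₂ * α ^ (s - r₂)) ≤ N₂ (δ / β) := by
      refine le_trans ?_ (h' δ β α hδ hw1 hw2 hle qb)
      gcongr
      exact min_le_right _ _
    refine ⟨le_trans ?_ hmain, hmain⟩
    exact mul_le_mul_of_nonneg_left (rpow_mul_rpow_le_swap pa hle (by linarith)) (by positivity)

theorem exists_sum_le_of_sum_sliceCount_le (ha : ∀ i, a i ∈ Ioo (0 : ℝ) 1)
    (hb : ∀ i, b i ∈ Ioo (0 : ℝ) 1) (hm : 0 < m) (h₁ : HasGrowth N₁ r₁) (h₂ : HasGrowth N₂ r₂)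
    {K : ℝ} (hK : 0 < K)
    (hlow : ∀ δ ∈ Ioo (0 : ℝ) 1, ∀ T : Finset (List I), CompleteFamily T →
      (∀ w ∈ T, AtScale a b m δ w) → ∑ w ∈ T, sliceCount N₁ N₂ a b δ w ≤ K * NF δ)
    {s : ℝ} (hs : s ≤ r₁ + r₂) {ε : ℝ} (hε : 0 < ε) :
    ∃ C > 0, ∀ δ ∈ Ioo (0 : ℝ) 1, ∀ T : Finset (List I), CompleteFamily T →
      (∀ w ∈ T, AtScale a b m δ w) →
      C * δ ^ (-s + ε) * ∑ w ∈ T, wordProd (fun i => a i ^ r₁ * b i ^ (s - r₁)) w ≤ NF δ ∧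
      C * δ ^ (-s + ε) * ∑ w ∈ T, wordProd (fun i => b i ^ r₂ * a i ^ (s - r₂)) w ≤ NF δ := by
  obtain ⟨C, hC, h⟩ := le_sliceCount ha hb hm h₁ h₂ hs hε
  refine ⟨C / K, by positivity, fun δ hδ T hT hTs => ?_⟩
  have e := hlow δ hδ T hT hTs
  rw [← div_le_iff₀' hK] at e
  have e' : ∀ x y : ℝ, C / K * x * y = (C * x * y) / K := fun x y => by ring
  constructor
  · refine le_trans ?_ e
    rw [e', Finset.mul_sum]
    exact div_le_div_of_nonneg_right (Finset.sum_le_sum fun w hw => (h δ hδ.1 w (hTs w hw)).1)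
      hK.le
  · refine le_trans ?_ e
    rw [e', Finset.mul_sum]
    exact div_le_div_of_nonneg_right (Finset.sum_le_sum fun w hw => (h δ hδ.1 w (hTs w hw)).2)
      hK.le

variable [Fintype I]

/-- The sum `∑ a ^ r₁ * b ^ r₂` is at most `1`, because the covering numbers of `F` are bounded by
the products of those of the projections. -/
theorem sum_rpow_mul_rpow_le_one (ha : ∀ i, a i ∈ Ioo (0 : ℝ) 1)
    (hb : ∀ i, b i ∈ Ioo (0 : ℝ) 1) (hm : 0 < m) (hma : ∀ i, m ≤ a i) (hmb : ∀ i, m ≤ b i)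
    (h₁ : HasGrowth N₁ r₁) (h₂ : HasGrowth N₂ r₂) (hN₁ : ∀ δ, 0 < δ → 1 ≤ N₁ δ)
    {K : ℝ} (hK : 0 < K)
    (hlow : ∀ δ ∈ Ioo (0 : ℝ) 1, ∀ T : Finset (List I), CompleteFamily T →
      (∀ w ∈ T, AtScale a b m δ w) → ∑ w ∈ T, sliceCount N₁ N₂ a b δ w ≤ K * NF δ)
    (hprod : ∀ δ, 0 < δ → NF (2 * δ) ≤ N₁ δ * N₂ δ) :
    ∑ i, a i ^ r₁ * b i ^ r₂ ≤ 1 := by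
  by_contra! hcon
  have hcont : Continuous fun κ : ℝ => ∑ i, a i ^ (r₁ + κ) * b i ^ (r₂ + κ) := by
    refine continuous_finsetSum _ fun i _ => ?_
    exact ((Real.continuous_const_rpow (ha i).1.ne').comp (continuous_const.add continuous_id)).mul
      ((Real.continuous_const_rpow (hb i).1.ne').comp (continuous_const.add continuous_id))
  have hev : ∀ᶠ κ in 𝓝[>] (0 : ℝ), 1 < ∑ i, a i ^ (r₁ + κ) * b i ^ (r₂ + κ) := by
    refine (hcont.tendsto' 0 (∑ i, a i ^ r₁ * b i ^ r₂) (by simp)).eventually_const_lt hcon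
      |>.filter_mono nhdsWithin_le_nhds
  -- A sum strictly above 1 tolerates a small increase `κ` of both exponents.
  obtain ⟨κ, hκ, hκ0⟩ := (hev.and self_mem_nhdsWithin).exists
  -- The lower bound carries `δ ^ (ε - κ)` and the upper one `δ ^ (-2 * ε)`; with `κ = 6 * ε` a
  -- factor `δ ^ (-(3 * ε))` is left over.
  set ε := κ / 6 with hε
  have hε0 : 0 < ε := by positivity
  obtain ⟨c, hc, hclow⟩ :=
    exists_sum_le_of_sum_sliceCount_le ha hb hm h₁ h₂ hK hlow (le_refl (r₁ + r₂)) hε0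
  obtain ⟨C₁, hC₁, hb₁⟩ := h₁ ε hε0 1 one_pos
  obtain ⟨C₂, hC₂, hb₂⟩ := h₂ ε hε0 1 one_pos
  set C := C₁ * C₂ * (2⁻¹ : ℝ) ^ (-(r₁ + r₂) - 2 * ε) with hCdef
  have hCpos : 0 < C := by positivity
  set B := C / c + 2 with hB
  have hB1 : 1 < B := by
    have : 0 < C / c := by positivity
    linarith
  have hB0 : 0 < B := by linarith
  -- At this scale the leftover factor equals `B > C / c`, which contradicts the two bounds.
  set δ := B ^ (-(1 / (3 * ε))) with hδdef
  have hδ0 : 0 < δ := Real.rpow_pos_of_pos hB0 _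
  have hδ1 : δ < 1 := Real.rpow_lt_one_of_one_lt_of_neg hB1 (by
    rw [neg_lt_zero]; positivity)
  have hδB : δ ^ (-(3 * ε)) = B := by
    rw [hδdef, ← Real.rpow_mul hB0.le]
    have : -(1 / (3 * ε)) * -(3 * ε) = 1 := by field_simp
    rw [this, Real.rpow_one]
  obtain ⟨T, hT, hTs⟩ := exists_completeFamily hm hma hmb (fun i => (ha i).2) (fun i => (hb i).2)
    (δ := δ) ⟨hδ0, hδ1⟩
  have hl := (hclow δ ⟨hδ0, hδ1⟩ T hT hTs).1
  have hsum : δ ^ (-κ) ≤ ∑ w ∈ T, wordProd (fun i => a i ^ r₁ * b i ^ (r₁ + r₂ - r₁)) w := by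
    have h1 := hT.one_le_sum (p := fun i => a i ^ (r₁ + κ) * b i ^ (r₂ + κ)) (fun i =>
      mul_pos (Real.rpow_pos_of_pos (ha i).1 _) (Real.rpow_pos_of_pos (hb i).1 _)) hκ.le
    have hpos := Real.rpow_pos_of_pos hδ0 (-κ)
    rw [← mul_one (δ ^ (-κ))]
    refine (mul_le_mul_of_nonneg_left h1 hpos.le).trans ?_
    rw [Finset.mul_sum]
    refine Finset.sum_le_sum fun w hw => ?_
    rw [wordProd_rpow_mul_rpow (fun i => (ha i).1) (fun i => (hb i).1),
      wordProd_rpow_mul_rpow (fun i => (ha i).1) (fun i => (hb i).1), add_sub_cancel_left]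
    have pa := wordProd_pos (fun i => (ha i).1) w
    have pb := wordProd_pos (fun i => (hb i).1) w
    have qa := wordProd_le_one (fun i => (ha i).1) (fun i => (ha i).2.le) w
    have qb := wordProd_le_one (fun i => (hb i).1) (fun i => (hb i).2.le) w
    have hmin := (hTs w hw).2
    set α := wordProd a w
    set β := wordProd b w
    -- The product of the sides is at most the shorter one, so lowering both exponents by `κ` gains
    -- a factor `δ ^ (-κ)`.
    have hαβ : α * β ≤ δ := by
      refine le_trans ?_ hmin
      exact le_min (mul_le_of_le_one_right pa.le qb) (mul_le_of_le_one_left pb.le qa)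
    have h2 : (α * β) ^ κ ≤ δ ^ κ := Real.rpow_le_rpow (mul_pos pa pb).le hαβ hκ0.le
    rw [Real.rpow_add pa, Real.rpow_add pb, Real.rpow_neg hδ0.le, inv_mul_le_iff₀
      (Real.rpow_pos_of_pos hδ0 _)]
    rw [Real.mul_rpow pa.le pb.le] at h2
    have h3 : 0 < α ^ r₁ * β ^ r₂ :=
      mul_pos (Real.rpow_pos_of_pos pa _) (Real.rpow_pos_of_pos pb _)
    nlinarith
  have hu : NF δ ≤ C * δ ^ (-(r₁ + r₂) - 2 * ε) := by
    have hhalf : δ / 2 ∈ Ioo (0 : ℝ) 1 := ⟨by positivity, by linarith⟩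
    have h3 := hprod (δ / 2) hhalf.1
    rw [mul_div_cancel₀ _ two_ne_zero] at h3
    have h4 := (hb₁ _ hhalf).2
    have h5 := (hb₂ _ hhalf).2
    refine h3.trans ((mul_le_mul_of_nonneg_left h5
      (zero_le_one.trans (hN₁ _ hhalf.1))).trans ?_)
    have p2 := Real.rpow_pos_of_pos hhalf.1 (-r₂ - ε)
    refine (mul_le_mul_of_nonneg_right h4 (by positivity)).trans (le_of_eq ?_)
    have e1 : C₁ * (δ / 2) ^ (-r₁ - ε) * (C₂ * (δ / 2) ^ (-r₂ - ε)) =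
        C₁ * C₂ * ((δ / 2) ^ (-r₁ - ε) * (δ / 2) ^ (-r₂ - ε)) := by ring
    rw [e1, ← Real.rpow_add hhalf.1, div_eq_mul_inv, Real.mul_rpow hδ0.le (by norm_num), hCdef]
    have e2 : -r₁ - ε + (-r₂ - ε) = -(r₁ + r₂) - 2 * ε := by ring
    rw [e2]
    ring
  have hall : c * δ ^ (-(r₁ + r₂) + ε) * δ ^ (-κ) ≤ C * δ ^ (-(r₁ + r₂) - 2 * ε) :=
    (mul_le_mul_of_nonneg_left hsum (by positivity)).trans (hl.trans hu)
  have e3 : c * δ ^ (-(r₁ + r₂) + ε) * δ ^ (-κ) = c * B * δ ^ (-(r₁ + r₂) - 2 * ε) := by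
    rw [← hδB, mul_assoc, mul_assoc, ← Real.rpow_add hδ0, ← Real.rpow_add hδ0]
    congr 2
    rw [hε]
    ring
  rw [e3] at hall
  have h6 := le_of_mul_le_mul_right hall (Real.rpow_pos_of_pos hδ0 _)
  have h7 : c * B = C + 2 * c := by
    rw [hB]
    field_simp
  linarith

/-- The growth exponent of the covering numbers of a self-affine set is determined by its
approximation by slices. -/
theorem hasGrowth_of_sliceCount [Nonempty I] (ha : ∀ i, a i ∈ Ioo (0 : ℝ) 1)
    (hb : ∀ i, b i ∈ Ioo (0 : ℝ) 1) (hm : 0 < m) (hma : ∀ i, m ≤ a i) (hmb : ∀ i, m ≤ b i)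
    (h₁ : HasGrowth N₁ r₁) (h₂ : HasGrowth N₂ r₂) (hN₁ : ∀ δ, 0 < δ → 1 ≤ N₁ δ)
    {K : ℝ} (hK : 0 < K)
    (hlow : ∀ δ ∈ Ioo (0 : ℝ) 1, ∀ T : Finset (List I), CompleteFamily T →
      (∀ w ∈ T, AtScale a b m δ w) → ∑ w ∈ T, sliceCount N₁ N₂ a b δ w ≤ K * NF δ)
    (hupp : ∀ δ ∈ Ioo (0 : ℝ) 1, ∀ T : Finset (List I), CompleteFamily T →
      (∀ w ∈ T, AtScale a b m δ w) → NF (2 * δ) ≤ ∑ w ∈ T, sliceCount N₁ N₂ a b δ w)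
    (hprod : ∀ δ, 0 < δ → NF (2 * δ) ≤ N₁ δ * N₂ δ)
    (hanti : ∀ δ δ', 0 < δ → δ ≤ δ' → NF δ' ≤ NF δ) (hone : ∀ δ, 0 < δ → 1 ≤ NF δ) {t : ℝ}
    (ht : max (∑ i, a i ^ r₁ * b i ^ (t - r₁)) (∑ i, b i ^ r₂ * a i ^ (t - r₂)) = 1) :
    HasGrowth NF t := by
  have hle := sum_rpow_mul_rpow_le_one ha hb hm hma hmb h₁ h₂ hN₁ hK hlow hprod
  -- At `s = r₁ + r₂` both sums become `∑ a ^ r₁ * b ^ r₂ ≤ 1`, and the maximum is strictly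
  -- decreasing in `s`.
  have htr : t ≤ r₁ + r₂ := by
    by_contra! hcon
    have h := max_sum_rpow_strictAnti ha hb r₁ r₂ hcon
    simp only [ht, add_sub_cancel_left, add_sub_cancel_right] at h
    refine h.not_ge (max_le hle ?_)
    simpa only [mul_comm] using hle
  have hp1 : ∀ i, 0 < a i ^ r₁ * b i ^ (t - r₁) := fun i =>
    mul_pos (Real.rpow_pos_of_pos (ha i).1 _) (Real.rpow_pos_of_pos (hb i).1 _)
  have hp2 : ∀ i, 0 < b i ^ r₂ * a i ^ (t - r₂) := fun i =>
    mul_pos (Real.rpow_pos_of_pos (hb i).1 _) (Real.rpow_pos_of_pos (ha i).1 _)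
  refine HasGrowth.of_antitone hanti hone fun ε hε => ?_
  obtain ⟨c, hc, hcl⟩ := exists_sum_le_of_sum_sliceCount_le ha hb hm h₁ h₂ hK hlow htr hε
  obtain ⟨C, hC, hCu⟩ := sliceCount_le (r₁ := r₁) (r₂ := r₂) ha hb hm h₁ h₂ t hε
  set D := C * (2⁻¹ : ℝ) ^ (-t - ε) * 2 with hD
  have hDpos : 0 < D := by positivity
  refine ⟨1, one_pos, c⁻¹ + D, by positivity, fun δ hδ => ?_⟩
  constructor
  · obtain ⟨T, hT, hTs⟩ := exists_completeFamily hm hma hmb (fun i => (ha i).2)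
      (fun i => (hb i).2) hδ
    obtain ⟨k1, k2⟩ := hcl δ hδ T hT hTs
    have hpos : 0 < δ ^ (-t + ε) := Real.rpow_pos_of_pos hδ.1 _
    have h1 : c * δ ^ (-t + ε) ≤ NF δ := by
      rw [← mul_one (c * δ ^ (-t + ε))]
      -- Only the sum attaining the maximum is known to be 1, but by `htr` the slices dominate
      -- either weight.
      rcases max_choice (∑ i, a i ^ r₁ * b i ^ (t - r₁)) (∑ i, b i ^ r₂ * a i ^ (t - r₂)) with
        h | h <;> rw [h] at ht
      · exact (mul_le_mul_of_nonneg_left (hT.one_le_sum hp1 ht.ge) (by positivity)).trans k1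
      · exact (mul_le_mul_of_nonneg_left (hT.one_le_sum hp2 ht.ge) (by positivity)).trans k2
    refine le_trans (mul_le_mul_of_nonneg_right ?_ hpos.le) h1
    exact inv_le_of_inv_le₀ hc (by linarith)
  · have hhalf : δ / 2 ∈ Ioo (0 : ℝ) 1 := ⟨by linarith [hδ.1], by linarith [hδ.2]⟩
    obtain ⟨T, hT, hTs⟩ := exists_completeFamily hm hma hmb (fun i => (ha i).2)
      (fun i => (hb i).2) hhalf
    have h1 := hupp _ hhalf T hT hTs
    rw [mul_div_cancel₀ _ two_ne_zero] at h1
    have h2 := Finset.sum_le_sum fun w hw => hCu _ hhalf.1 w (hTs w hw)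
    rw [← Finset.mul_sum, Finset.sum_add_distrib] at h2
    have h3 := hT.sum_le_one hp1 ((le_max_left _ _).trans ht.le)
    have h4 := hT.sum_le_one hp2 ((le_max_right _ _).trans ht.le)
    have hpos : 0 < δ ^ (-t - ε) := Real.rpow_pos_of_pos hδ.1 _
    have hpos' : 0 < (δ / 2) ^ (-t - ε) := Real.rpow_pos_of_pos hhalf.1 _
    calc NF δ ≤ C * (δ / 2) ^ (-t - ε) * (1 + 1) :=
          h1.trans (h2.trans (mul_le_mul_of_nonneg_left (add_le_add h3 h4) (by positivity)))
      _ = D * δ ^ (-t - ε) := by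
          rw [div_eq_mul_inv, Real.mul_rpow hδ.1.le (by norm_num), hD]; ring
      _ ≤ (c⁻¹ + D) * δ ^ (-t - ε) :=
          mul_le_mul_of_nonneg_right (by linarith [inv_pos.2 hc]) hpos.le

end Slices

/-! ### Packing measures and covering numbers. -/

section Packing

variable {X : Type*} [PseudoMetricSpace X] {F : Set X} {t : ℝ}

theorem packingPre_mono (s : ℝ≥0) {E G : Set X} (h : E ⊆ G) : packingPre s E ≤ packingPre s G := by
  refine iInf₂_mono fun δ _ => iSup₂_le fun T hT => ?_
  exact le_iSup₂_of_le T ⟨fun p hp => ⟨h (hT.1 p hp).1, (hT.1 p hp).2⟩, hT.2⟩ le_rfl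

/-- Sort the balls by dyadic radius. Centres of disjoint balls in one class are further apart than
the lower radius bound, so the covering number at that scale bounds their number. -/
theorem packingPreDelta_le_tsum (s : ℝ≥0) (n₀ : ℕ) :
    packingPreDelta s ((2⁻¹ : ℝ) ^ n₀) F ≤
      ∑' k : ℕ, ((deltaCoverNumber ((2⁻¹ : ℝ) ^ (k + n₀ + 1)) F : ℕ∞) : ℝ≥0∞) *
        ENNReal.ofReal (2 * (2⁻¹ : ℝ) ^ (k + n₀)) ^ (s : ℝ) := by
  refine iSup₂_le fun T hT => ?_
  let P : ℕ → Set (X × ℝ) := fun k =>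
    {p | p ∈ T ∧ (2⁻¹ : ℝ) ^ (k + n₀ + 1) < p.2 ∧ p.2 ≤ (2⁻¹ : ℝ) ^ (k + n₀)}
  have hsub : T ⊆ ⋃ k, P k := by
    intro p hp
    obtain ⟨-, h1, h2⟩ := hT.1 p hp
    obtain ⟨n, hn1, hn2⟩ := exists_nat_pow_near_of_lt_one (y := (2⁻¹ : ℝ)) h1
      (h2.trans (pow_le_one₀ (by norm_num) (by norm_num))) (by norm_num) (by norm_num)
    have hn : n₀ < n + 1 := (pow_lt_pow_iff_right_of_lt_one₀ (by norm_num) (by norm_num)).1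
      (hn1.trans_le h2)
    obtain ⟨k, rfl⟩ := Nat.exists_eq_add_of_le' (Nat.lt_succ_iff.1 hn)
    exact mem_iUnion.2 ⟨k, hp, hn1, hn2⟩
  let g : X × ℝ → ℝ≥0∞ := fun p => ENNReal.ofReal (2 * p.2) ^ (s : ℝ)
  refine (ENNReal.tsum_mono_subtype g hsub).trans ((ENNReal.tsum_iUnion_le_tsum g P).trans ?_)
  refine ENNReal.tsum_le_tsum fun k => ?_
  have hcard : (P k).encard ≤ deltaCoverNumber ((2⁻¹ : ℝ) ^ (k + n₀ + 1)) F := by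
    refine encard_le_deltaCoverNumber (c := Prod.fst) (by positivity)
      (fun p hp => (hT.1 p hp.1).1) fun p hp q hq hne => ?_
    have hd := hT.2 hp.1 hq.1 hne
    have hq' : q.1 ∈ Metric.closedBall q.1 q.2 :=
      Metric.mem_closedBall_self (hT.1 q hq.1).2.1.le
    have := Set.disjoint_right.1 hd hq'
    rw [Metric.mem_closedBall, not_le, dist_comm] at this
    exact hp.2.1.trans this
  calc ∑' p : P k, g p ≤ ∑' _ : P k, ENNReal.ofReal (2 * (2⁻¹ : ℝ) ^ (k + n₀)) ^ (s : ℝ) := by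
        refine ENNReal.tsum_le_tsum fun p => ?_
        refine ENNReal.rpow_le_rpow (ENNReal.ofReal_le_ofReal ?_) s.2
        linarith [p.2.2.2]
    _ = ((P k).encard : ℝ≥0∞) * ENNReal.ofReal (2 * (2⁻¹ : ℝ) ^ (k + n₀)) ^ (s : ℝ) :=
        ENNReal.tsum_set_const _ _
    _ ≤ _ := by gcongr

theorem packingPre_eq_zero_of_hasGrowth (hfin : ∀ δ > 0, deltaCoverNumber δ F ≠ ⊤)
    (h : HasGrowth (coverCount F) t) {s : ℝ≥0} (hs : t < s) : packingPre s F = 0 := by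
  set ε := (s - t) / 2 with hε
  have hε0 : 0 < ε := half_pos (sub_pos.2 hs)
  obtain ⟨C, hC, hb⟩ := h ε hε0 2 two_pos
  set ρ : ℝ := (2⁻¹ : ℝ) ^ ε with hρ
  have hρ0 : 0 < ρ := Real.rpow_pos_of_pos (by norm_num) _
  have hρ1 : ρ < 1 := Real.rpow_lt_one (by norm_num) (by norm_num) hε0
  -- Since `s - t - ε = ε`, each dyadic term decays like `ρ ^ (n + 1)`; the factor `4 ^ s` comes
  -- from writing the diameter `2 * 2⁻¹ ^ n` as `4 * 2⁻¹ ^ (n + 1)`. The tails then tend to 0.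
  let f : ℕ → ℝ≥0∞ := fun n => ENNReal.ofReal (C * 4 ^ (s : ℝ) * ρ * ρ ^ n)
  have hf : ∑' n, f n ≠ ⊤ :=
    ((summable_geometric_of_lt_one hρ0.le hρ1).mul_left _).tsum_ofReal_ne_top
  have hterm : ∀ n : ℕ, ((deltaCoverNumber ((2⁻¹ : ℝ) ^ (n + 1)) F : ℕ∞) : ℝ≥0∞) *
      ENNReal.ofReal (2 * (2⁻¹ : ℝ) ^ n) ^ (s : ℝ) ≤ f n := by
    intro n
    have hδ : (0 : ℝ) < (2⁻¹ : ℝ) ^ (n + 1) := by positivity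
    have hδ1 : (2⁻¹ : ℝ) ^ (n + 1) < 2 :=
      (pow_le_one₀ (by norm_num) (by norm_num)).trans_lt one_lt_two
    rw [← ofReal_coverCount (hfin _ hδ), ENNReal.ofReal_rpow_of_pos (by positivity),
      ← ENNReal.ofReal_mul (by unfold coverCount; positivity)]
    refine ENNReal.ofReal_le_ofReal ?_
    have e1 : (2 : ℝ) * 2⁻¹ ^ n = 4 * 2⁻¹ ^ (n + 1) := by rw [pow_succ]; ring
    refine (mul_le_mul_of_nonneg_right (hb _ ⟨hδ, hδ1⟩).2 (by positivity)).trans (le_of_eq ?_)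
    rw [e1, Real.mul_rpow (by norm_num) hδ.le]
    have e2 : ((2⁻¹ : ℝ) ^ (n + 1)) ^ (-t - ε) * ((2⁻¹ : ℝ) ^ (n + 1)) ^ (s : ℝ) = ρ * ρ ^ n := by
      rw [← Real.rpow_add hδ, ← pow_succ', hρ, ← Real.rpow_natCast, ← Real.rpow_natCast,
        ← Real.rpow_mul (by norm_num), ← Real.rpow_mul (by norm_num)]
      congr 1
      rw [hε]
      ring
    calc _ = C * 4 ^ (s : ℝ) *
          (((2⁻¹ : ℝ) ^ (n + 1)) ^ (-t - ε) * ((2⁻¹ : ℝ) ^ (n + 1)) ^ (s : ℝ)) := by ring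
      _ = _ := by rw [e2]; ring
  refine le_antisymm (ge_of_tendsto' (ENNReal.tendsto_sum_nat_add f hf) fun n₀ => ?_) zero_le
  refine (iInf₂_le ((2⁻¹ : ℝ) ^ n₀) (by positivity)).trans ((packingPreDelta_le_tsum s n₀).trans ?_)
  exact ENNReal.tsum_le_tsum fun k => hterm (k + n₀)

theorem packingDim_le_of_hasGrowth (hfin : ∀ δ > 0, deltaCoverNumber δ F ≠ ⊤)
    (h : HasGrowth (coverCount F) t) : packingDim F ≤ ENNReal.ofReal t := by
  refine ENNReal.le_of_forall_pos_le_add fun ε hε _ => ?_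
  have hs : t < ((t.toNNReal + ε : ℝ≥0) : ℝ) := by
    push_cast
    have := Real.le_coe_toNNReal t
    have : (0 : ℝ) < ε := hε
    linarith
  have hzero : packingMeasure (t.toNNReal + ε) F = 0 := by
    refine le_antisymm ?_ zero_le
    refine (iInf₂_le (fun _ => F) (subset_iUnion (fun _ : ℕ => F) 0)).trans ?_
    simp [packingPre_eq_zero_of_hasGrowth hfin h hs]
  exact iInf₂_le (t.toNNReal + ε) hzero

/-- The `δ`-balls around a `2 * δ`-separated set form a packing, so a finite pre-measure bounds
their number by a multiple of `δ ^ (-s)`. A maximal such set controls covers at `4 * δ`. -/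
theorem exists_coverCount_le_of_packingPre_ne_top {s : ℝ≥0} {E : Set X}
    (hfin : ∀ δ > 0, deltaCoverNumber δ E ≠ ⊤) (h : packingPre s E ≠ ⊤) :
    ∃ δ₀ > 0, ∃ C : ℝ, ∀ δ ∈ Ioo 0 δ₀, coverCount E (4 * δ) ≤ C * δ ^ (-(s : ℝ)) := by
  classical
  obtain ⟨δ₀, hδ₀⟩ := iInf_lt_iff.1 (lt_top_iff_ne_top.2 h)
  obtain ⟨hδ₀0, hlt⟩ := iInf_lt_iff.1 hδ₀
  refine ⟨δ₀, hδ₀0, (packingPreDelta s δ₀ E).toReal, fun δ hδ => ?_⟩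
  have h2δ : 0 < 2 * δ := mul_pos two_pos hδ.1
  obtain ⟨S, hS, hsep, hcard⟩ := exists_separated h2δ.le (hfin _ h2δ)
  rw [← mul_assoc, show (2 : ℝ) * 2 = 4 by norm_num] at hcard
  have hinj : Function.Injective fun x : X => (x, δ) := fun x y h => (Prod.mk.inj h).1
  set T : Set (X × ℝ) := (fun x => (x, δ)) '' (S : Set X) with hT
  have hpack : IsBallPacking δ₀ E T := by
    constructor
    · rintro _ ⟨x, hx, rfl⟩
      exact ⟨hS hx, hδ.1, hδ.2.le⟩
    · rintro _ ⟨x, hx, rfl⟩ _ ⟨y, hy, rfl⟩ hne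
      refine Metric.closedBall_disjoint_closedBall ?_
      have := hsep hx hy fun h => hne (by rw [h])
      linarith
  have hsum : (S.card : ℝ≥0∞) * ENNReal.ofReal (2 * δ) ^ (s : ℝ) ≤ packingPreDelta s δ₀ E := by
    refine le_trans (le_of_eq ?_) (le_iSup₂_of_le T hpack le_rfl)
    have e1 : ∀ p : T, ENNReal.ofReal (2 * p.1.2) ^ (s : ℝ) = ENNReal.ofReal (2 * δ) ^ (s : ℝ) := by
      rintro ⟨_, x, _, rfl⟩
      rfl
    rw [tsum_congr e1, ENNReal.tsum_set_const, hT, hinj.encard_image,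
      Set.encard_coe_eq_coe_finsetCard]
    rfl
  have hsum' := ENNReal.toReal_mono hlt.ne hsum
  rw [ENNReal.toReal_mul, ENNReal.toReal_natCast, ← ENNReal.toReal_rpow,
    ENNReal.toReal_ofReal h2δ.le] at hsum'
  refine (coverCount_le_of_le_nat hcard).trans ?_
  have hpos : 0 < δ ^ (s : ℝ) := Real.rpow_pos_of_pos hδ.1 _
  rw [Real.rpow_neg hδ.1.le, ← div_eq_mul_inv, le_div_iff₀ hpos]
  refine le_trans (mul_le_mul_of_nonneg_left ?_ (Nat.cast_nonneg _)) hsum'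
  exact Real.rpow_le_rpow hδ.1.le (by linarith [hδ.1]) s.2

theorem HasGrowth.le_of_le_rpow {N : ℝ → ℝ} (h : HasGrowth N t) (hone : ∀ δ, 0 < δ → 1 ≤ N δ)
    {s C δ₀ : ℝ} (hδ₀ : 0 < δ₀) (hC : ∀ δ ∈ Ioo 0 δ₀, N δ ≤ C * δ ^ (-s)) : t ≤ s := by
  have hlog : Tendsto (fun δ => -Real.log δ) (𝓝[>] (0 : ℝ)) atTop :=
    tendsto_neg_atBot_atTop.comp Real.tendsto_log_nhdsGT_zero
  have hlim : Tendsto (fun δ => Real.log C / -Real.log δ + s) (𝓝[>] (0 : ℝ)) (𝓝 (0 + s)) :=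
    (hlog.const_div_atTop _).add_const s
  rw [zero_add] at hlim
  refine le_of_tendsto_of_tendsto h.tendsto hlim ?_
  filter_upwards [Ioo_mem_nhdsGT hδ₀, hlog.eventually_gt_atTop 0] with δ hδ hl
  have hN := zero_lt_one.trans_le (hone δ hδ.1)
  have hp := Real.rpow_pos_of_pos hδ.1 (-s)
  have hCpos : 0 < C := pos_of_mul_pos_left (hN.trans_le (hC δ hδ)) hp.le
  have h1 := Real.log_le_log hN (hC δ hδ)
  rw [Real.log_mul hCpos.ne' hp.ne', Real.log_rpow hδ.1] at h1
  rw [div_add' _ _ _ hl.ne']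
  exact div_le_div_of_nonneg_right (by linarith) hl.le

end Packing

/-! ### Coding, Baire category and the lower packing bound. -/

section LimitSet

theorem prefixMap_eq_wordMap {I X : Type*} (A : I → X → X) (ω : ℕ → I) (n : ℕ) :
    prefixMap A ω n = wordMap A ((List.range n).map ω) := by
  induction n with
  | zero => rfl
  | succ n ih =>
    rw [prefixMap, ih, List.range_succ, List.map_append, wordMap_append]
    rfl

theorem prefixMap_add {I X : Type*} (A : I → X → X) (ω : ℕ → I) (n k : ℕ) :
    prefixMap A ω (n + k) = prefixMap A ω n ∘ prefixMap A (fun j => ω (n + j)) k := by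
  rw [prefixMap_eq_wordMap, List.range_add, List.map_append, wordMap_append, List.map_map,
    ← prefixMap_eq_wordMap, prefixMap_eq_wordMap A (fun j => ω (n + j))]
  rfl

theorem prefixMap_congr {I X : Type*} (A : I → X → X) {ω ω' : ℕ → I} {n : ℕ}
    (h : ∀ k < n, ω k = ω' k) : prefixMap A ω n = prefixMap A ω' n := by
  rw [prefixMap_eq_wordMap, prefixMap_eq_wordMap]
  congr 1
  exact List.map_congr_left fun k hk => h k (List.mem_range.1 hk)

theorem prefixMap_image_antitone {I X : Type*} {A : I → X → X} {S : Set X}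
    (h : ∀ i, MapsTo (A i) S S) (ω : ℕ → I) : Antitone fun n => prefixMap A ω n '' S := by
  refine antitone_nat_of_succ_le fun n => ?_
  rw [prefixMap, image_comp]
  exact image_mono (h _).image_subset

theorem mapsTo_limitSet {I X : Type*} {A : I → X → X} {S : Set X} (h : ∀ i, MapsTo (A i) S S)
    (i : I) : MapsTo (A i) (limitSet A S) (limitSet A S) := by
  intro x hx
  obtain ⟨ω, hω⟩ := mem_iUnion.1 hx
  rw [mem_iInter] at hω
  refine mem_iUnion.2 ⟨fun n => Nat.casesOn n i ω, mem_iInter.2 fun n => ?_⟩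
  -- Passing to level `1 + n` makes the prefix begin with `i`, which fails at level 0.
  refine prefixMap_image_antitone h _ (Nat.le_add_left n 1) ?_
  obtain ⟨y, hy, hyx⟩ := hω n
  refine ⟨y, hy, ?_⟩
  rw [prefixMap_add]
  change A i (prefixMap A (fun j => Nat.casesOn (1 + j) i ω) n y) = A i x
  rw [← hyx]
  congr 1
  have : (fun j => Nat.casesOn (1 + j) i ω : ℕ → I) = ω := funext fun j => by
    rw [Nat.add_comm]
  rw [this]

/-- Each level supplies a preimage under the first map; by injectivity all of them are the same
point, which therefore lies in every level of the shifted word. -/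
theorem exists_eq_of_mem_limitSet {I X : Type*} {A : I → X → X} {S : Set X}
    (hinj : ∀ i, Function.Injective (A i)) {x : X} (hx : x ∈ limitSet A S) :
    ∃ i, ∃ y ∈ limitSet A S, A i y = x := by
  obtain ⟨ω, hω⟩ := mem_iUnion.1 hx
  rw [mem_iInter] at hω
  have hstep : ∀ n, ∃ y ∈ prefixMap A (fun j => ω (1 + j)) n '' S, A (ω 0) y = x := by
    intro n
    obtain ⟨z, hz, hzx⟩ := hω (1 + n)
    rw [prefixMap_add] at hzx
    exact ⟨_, ⟨z, hz, rfl⟩, hzx⟩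
  obtain ⟨y, -, hyx⟩ := hstep 0
  refine ⟨ω 0, y, mem_iUnion.2 ⟨fun j => ω (1 + j), mem_iInter.2 fun n => ?_⟩, hyx⟩
  obtain ⟨y', hy', hyx'⟩ := hstep n
  rwa [hinj _ (hyx.trans hyx'.symm)]

theorem limitSet_subset {I X : Type*} (A : I → X → X) (S : Set X) : limitSet A S ⊆ S := by
  intro x hx
  obtain ⟨ω, hω⟩ := mem_iUnion.1 hx
  obtain ⟨y, hy, rfl⟩ := mem_iInter.1 hω 0
  exact hy

theorem continuous_diagAffine (a b : ℝ) (v : Plane) : Continuous (diagAffine a b v) := by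
  refine (LipschitzWith.of_dist_le_mul (K := (|a| + |b|).toNNReal) fun x y => ?_).continuous
  refine (dist_plane_le _ _).trans ?_
  rw [abs_diagAffine_zero_sub, abs_diagAffine_one_sub, Real.coe_toNNReal _ (by positivity),
    add_mul]
  exact add_le_add (mul_le_mul_of_nonneg_left (abs_sub_le_dist_plane _ _ _) (abs_nonneg _))
    (mul_le_mul_of_nonneg_left (abs_sub_le_dist_plane _ _ _) (abs_nonneg _))

theorem isCompact_unitSquare : IsCompact unitSquare := by
  refine Metric.isCompact_of_isClosed_isBounded ?_ ?_
  · have : unitSquare = ⋂ k, {x : Plane | x k ∈ Icc (0 : ℝ) 1} := by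
      ext x; simp [unitSquare]
    rw [this]
    exact isClosed_iInter fun k => isClosed_Icc.preimage (by fun_prop)
  · refine Metric.isBounded_iff.2 ⟨2, fun x hx y hy => (dist_plane_le x y).trans ?_⟩
    linarith [abs_sub_le_one_of_mem_unitSquare hx hy 0, abs_sub_le_one_of_mem_unitSquare hx hy 1]

variable {I : Type*} {A : I → Plane → Plane} {a b : I → ℝ} {v : I → Plane}

theorem dist_wordMap_le (hA : ∀ i, A i = diagAffine (a i) (b i) (v i)) {l : ℝ}
    (ha : ∀ i, |a i| ≤ l) (hb : ∀ i, |b i| ≤ l) (w : List I) {x y : Plane} (hx : x ∈ unitSquare)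
    (hy : y ∈ unitSquare) : dist (wordMap A w x) (wordMap A w y) ≤ 2 * l ^ w.length := by
  have key : ∀ p : I → ℝ, (∀ i, |p i| ≤ l) → |wordProd p w| ≤ l ^ w.length := by
    intro p hp
    induction w with
    | nil => simp
    | cons i w ih =>
      rw [wordProd_cons, abs_mul, List.length_cons, pow_succ']
      exact mul_le_mul (hp i) ih (abs_nonneg _) ((abs_nonneg _).trans (hp i))
  obtain ⟨d, hd⟩ := exists_wordMap_eq_diagAffine hA w
  rw [hd]
  refine (dist_plane_le _ _).trans ?_
  rw [abs_diagAffine_zero_sub, abs_diagAffine_one_sub]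
  have h0 := abs_sub_le_one_of_mem_unitSquare hx hy 0
  have h1 := abs_sub_le_one_of_mem_unitSquare hx hy 1
  have ka := key a ha
  have kb := key b hb
  nlinarith [abs_nonneg (wordProd a w), abs_nonneg (wordProd b w)]

theorem dist_le_of_mem_prefixMap_image (hA : ∀ i, A i = diagAffine (a i) (b i) (v i)) {l : ℝ}
    (ha : ∀ i, |a i| ≤ l) (hb : ∀ i, |b i| ≤ l) (ω : ℕ → I) (n : ℕ) {x y : Plane}
    (hx : x ∈ prefixMap A ω n '' unitSquare) (hy : y ∈ prefixMap A ω n '' unitSquare) :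
    dist x y ≤ 2 * l ^ n := by
  obtain ⟨x, hx, rfl⟩ := hx
  obtain ⟨y, hy, rfl⟩ := hy
  rw [prefixMap_eq_wordMap]
  simpa using dist_wordMap_le hA ha hb ((List.range n).map ω) hx hy

theorem exists_bound_lt_one [Finite I] (ha : ∀ i, |a i| < 1) (hb : ∀ i, |b i| < 1) :
    ∃ l : ℝ, 0 ≤ l ∧ l < 1 ∧ (∀ i, |a i| ≤ l) ∧ ∀ i, |b i| ≤ l := by
  rcases isEmpty_or_nonempty I with hI | hI
  · exact ⟨0, le_rfl, one_pos, fun i => isEmptyElim i, fun i => isEmptyElim i⟩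
  · obtain ⟨i, hi⟩ := Finite.exists_max fun i => max |a i| |b i|
    exact ⟨max |a i| |b i|, (abs_nonneg _).trans (le_max_left _ _), max_lt (ha i) (hb i),
      fun j => (le_max_left _ _).trans (hi j), fun j => (le_max_right _ _).trans (hi j)⟩

theorem exists_two_mul_pow_lt {l : ℝ} (h1 : l < 1) {ε : ℝ} (hε : 0 < ε) :
    ∃ n : ℕ, 2 * l ^ n < ε := by
  obtain ⟨n, hn⟩ := exists_pow_lt_of_lt_one (half_pos hε) h1
  exact ⟨n, by linarith⟩

/-- Every infinite word codes exactly one point. -/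
theorem existsUnique_code [Finite I] (hA : ∀ i, A i = diagAffine (a i) (b i) (v i))
    (ha : ∀ i, |a i| < 1) (hb : ∀ i, |b i| < 1) (hmaps : ∀ i, MapsTo (A i) unitSquare unitSquare)
    (ω : ℕ → I) : ∃! x, ∀ n, x ∈ prefixMap A ω n '' unitSquare := by
  have hcont : ∀ n, Continuous (prefixMap A ω n) := by
    intro n
    obtain ⟨d, hd⟩ := exists_wordMap_eq_diagAffine hA ((List.range n).map ω)
    rw [prefixMap_eq_wordMap, hd]
    exact continuous_diagAffine _ _ _
  have hcpt : ∀ n, IsCompact (prefixMap A ω n '' unitSquare) := fun n =>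
    isCompact_unitSquare.image (hcont n)
  have hne : unitSquare.Nonempty := ⟨0, fun k => by simp⟩
  obtain ⟨x, hx⟩ := IsCompact.nonempty_iInter_of_sequence_nonempty_isCompact_isClosed
    (fun n => prefixMap A ω n '' unitSquare)
    (fun n => prefixMap_image_antitone hmaps ω n.le_succ) (fun n => hne.image _) (hcpt 0)
    (fun n => (hcpt n).isClosed)
  rw [mem_iInter] at hx
  refine ⟨x, hx, fun y hy => ?_⟩
  obtain ⟨l, -, hl1, hal, hbl⟩ := exists_bound_lt_one ha hb
  refine eq_of_forall_dist_le fun ε hε => ?_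
  obtain ⟨n, hn⟩ := exists_two_mul_pow_lt hl1 hε
  exact (dist_le_of_mem_prefixMap_image hA hal hbl ω n (hy n) (hx n)).trans hn.le

/-- The limit set lies in the closure of every rectangle mapped into itself. -/
theorem limitSet_subset_closedRect [Finite I] (hA : ∀ i, A i = diagAffine (a i) (b i) (v i))
    (ha : ∀ i, |a i| < 1) (hb : ∀ i, |b i| < 1) {p q : Fin 2 → ℝ} (hpq : ∀ k, p k < q k)
    (hsub : openRect p q ⊆ unitSquare) (hU : ∀ i, MapsTo (A i) (openRect p q) (openRect p q))
    {x : Plane} (hx : x ∈ limitSet A unitSquare) (k : Fin 2) : x k ∈ Icc (p k) (q k) := by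
  obtain ⟨ω, hω⟩ := mem_iUnion.1 hx
  rw [mem_iInter] at hω
  obtain ⟨l, -, hl1, hal, hbl⟩ := exists_bound_lt_one ha hb
  have hne : WithLp.toLp 2 (fun k => (p k + q k) / 2) ∈ openRect p q := fun k => by
    have := hpq k
    constructor
    · change p k < (p k + q k) / 2; linarith
    · change (p k + q k) / 2 < q k; linarith
  have key : ∀ ε > 0, p k - ε ≤ x k ∧ x k ≤ q k + ε := by
    intro ε hε
    obtain ⟨n, hn⟩ := exists_two_mul_pow_lt hl1 hε
    have hmem : prefixMap A ω n (WithLp.toLp 2 fun k => (p k + q k) / 2) ∈ openRect p q := by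
      rw [prefixMap_eq_wordMap]
      exact mapsTo_wordMap hU _ hne
    have h1 := (abs_sub_le_dist_plane _ _ k).trans
      (dist_le_of_mem_prefixMap_image hA hal hbl ω n (hω n) ⟨_, hsub hne, rfl⟩)
    have h2 := hmem k
    rw [abs_le] at h1
    constructor <;> linarith [h2.1, h2.2]
  exact ⟨le_of_forall_pos_sub_le fun ε hε => (key ε hε).1,
    le_of_forall_pos_le_add fun ε hε => (key ε hε).2⟩

theorem limitSet_nonempty [Finite I] [Nonempty I]
    (hA : ∀ i, A i = diagAffine (a i) (b i) (v i))
    (ha : ∀ i, |a i| < 1) (hb : ∀ i, |b i| < 1)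
    (hmaps : ∀ i, MapsTo (A i) unitSquare unitSquare) : (limitSet A unitSquare).Nonempty := by
  obtain ⟨x, hx, -⟩ := existsUnique_code hA ha hb hmaps fun _ => Classical.arbitrary I
  exact ⟨x, mem_iUnion.2 ⟨_, mem_iInter.2 hx⟩⟩

/-- If the limit set is covered by countably many closed sets, one of them contains a cylinder. -/
theorem exists_wordMap_image_subset [Finite I] [Nonempty I]
    (hA : ∀ i, A i = diagAffine (a i) (b i) (v i))
    (ha : ∀ i, |a i| < 1) (hb : ∀ i, |b i| < 1)
    (hmaps : ∀ i, MapsTo (A i) unitSquare unitSquare) {E : ℕ → Set Plane}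
    (hE : ∀ n, IsClosed (E n)) (hcov : limitSet A unitSquare ⊆ ⋃ n, E n) :
    ∃ n, ∃ w, wordMap A w '' limitSet A unitSquare ⊆ E n := by
  let _ : TopologicalSpace I := ⊥
  have : DiscreteTopology I := ⟨rfl⟩
  choose code hcode huniq using existsUnique_code hA ha hb hmaps
  obtain ⟨l, -, hl1, hal, hbl⟩ := exists_bound_lt_one ha hb
  have hcont : Continuous code := by
    refine continuous_iff_continuousAt.2 fun ω => Metric.tendsto_nhds.2 fun ε hε => ?_
    obtain ⟨n, hn⟩ := exists_two_mul_pow_lt hl1 hε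
    filter_upwards [(PiNat.isOpen_cylinder (fun _ => I) ω n).mem_nhds
      (PiNat.self_mem_cylinder ω n)] with ω' hω'
    refine lt_of_le_of_lt (dist_le_of_mem_prefixMap_image hA hal hbl ω n ?_ (hcode ω n)) hn
    rw [← prefixMap_congr A fun k hk => hω' k hk]
    exact hcode ω' n
  have hrange : ∀ ω, code ω ∈ limitSet A unitSquare := fun ω =>
    mem_iUnion.2 ⟨ω, mem_iInter.2 (hcode ω)⟩
  -- Baire's theorem is applied to the sequence space: the preimages of the closed sets under the
  -- coding map cover it, so one has interior and contains a cylinder.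
  obtain ⟨n, ω, hω⟩ := nonempty_interior_of_iUnion_of_closed
    (f := fun n => code ⁻¹' E n) (fun n => (hE n).preimage hcont) (by
      refine eq_univ_of_forall fun ω => ?_
      obtain ⟨n, hn⟩ := mem_iUnion.1 (hcov (hrange ω))
      exact mem_iUnion.2 ⟨n, hn⟩)
  obtain ⟨_, ⟨x, k, rfl⟩, -, hsub⟩ :=
    (PiNat.isTopologicalBasis_cylinders fun _ : ℕ => I).exists_subset_of_mem_open hω
      isOpen_interior
  refine ⟨n, (List.range k).map x, ?_⟩
  rintro _ ⟨y, hy, rfl⟩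
  obtain ⟨η, hη⟩ := mem_iUnion.1 hy
  rw [mem_iInter] at hη
  -- The prefix of the cylinder followed by a code of `y`; it codes the image of `y` under the word
  -- map.
  set ω' : ℕ → I := fun j => if j < k then x j else η (j - k) with hω'
  have hcyl : ω' ∈ PiNat.cylinder x k := fun j hj => by simp [hω', hj]
  have hpre : prefixMap A ω' k = wordMap A ((List.range k).map x) := by
    rw [← prefixMap_eq_wordMap]
    exact prefixMap_congr A fun j hj => hcyl j hj
  have htail : (fun j => ω' (k + j)) = η := funext fun j => by simp [hω']
  have heq : wordMap A ((List.range k).map x) y = code ω' := by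
    refine huniq ω' _ fun j => ?_
    refine prefixMap_image_antitone hmaps ω' (Nat.le_add_left j k) ?_
    obtain ⟨z, hz, hzy⟩ := hη j
    refine ⟨z, hz, ?_⟩
    rw [prefixMap_add, htail, Function.comp_apply, hzy, hpre]
  rw [heq]
  have hmem : ω' ∈ code ⁻¹' E n := interior_subset (hsub hcyl)
  exact hmem

/-- If the `s`-dimensional packing measure vanishes, F is covered by pieces whose covering numbers
are `O(δ ^ (-s))`, and closures obey the same bound. One closure contains a cylinder, an affine copy
of F, so `t ≤ s`. -/
theorem le_packingDim_limitSet [Finite I] [Nonempty I]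
    (hA : ∀ i, A i = diagAffine (a i) (b i) (v i)) (ha0 : ∀ i, a i ≠ 0) (hb0 : ∀ i, b i ≠ 0)
    (ha : ∀ i, |a i| < 1) (hb : ∀ i, |b i| < 1)
    (hmaps : ∀ i, MapsTo (A i) unitSquare unitSquare)
    (hfin : ∀ δ > 0, deltaCoverNumber δ (limitSet A unitSquare) ≠ ⊤) {t : ℝ}
    (h : HasGrowth (coverCount (limitSet A unitSquare)) t) :
    ENNReal.ofReal t ≤ packingDim (limitSet A unitSquare) := by
  set F := limitSet A unitSquare with hF
  have hne : F.Nonempty := limitSet_nonempty hA ha hb hmaps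
  refine le_iInf₂ fun s hs => ?_
  have hlt : packingMeasure s F < 1 := by rw [hs]; exact zero_lt_one
  obtain ⟨E, hE⟩ := iInf_lt_iff.1 hlt
  obtain ⟨hcov, hsum⟩ := iInf_lt_iff.1 hE
  -- Intersecting with F makes the covering numbers of the pieces finite.
  have hEn : ∀ n, packingPre s (E n ∩ F) ≠ ⊤ := fun n =>
    ne_top_of_le_ne_top (ENNReal.ne_top_of_tsum_ne_top (hsum.trans ENNReal.one_lt_top).ne n)
      (packingPre_mono s inter_subset_left)
  obtain ⟨n, w, hw⟩ := exists_wordMap_image_subset hA ha hb hmaps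
    (E := fun n => closure (E n ∩ F)) (fun n => isClosed_closure) (by
      intro x hx
      obtain ⟨n, hn⟩ := mem_iUnion.1 (hcov hx)
      exact mem_iUnion.2 ⟨n, subset_closure ⟨hn, hx⟩⟩)
  have hfinE : ∀ δ > 0, deltaCoverNumber δ (E n ∩ F) ≠ ⊤ := fun δ hδ =>
    ne_top_of_le_ne_top (hfin δ hδ) (deltaCoverNumber_mono δ inter_subset_right)
  obtain ⟨δ₀, hδ₀, C, hC⟩ := exists_coverCount_le_of_packingPre_ne_top hfinE (hEn n)
  obtain ⟨d, hd⟩ := exists_wordMap_eq_diagAffine hA w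
  have hprod : ∀ p : I → ℝ, (∀ i, p i ≠ 0) → 0 < |wordProd p w| := fun p hp => by
    rw [← wordProd_abs]
    exact wordProd_pos (fun i => abs_pos.2 (hp i)) w
  set m := min |wordProd a w| |wordProd b w| with hm
  have hm0 : 0 < m := lt_min (hprod a ha0) (hprod b hb0)
  have hbound : ∀ δ ∈ Ioo 0 (8 * δ₀ / m),
      coverCount F δ ≤ C * (m / 8) ^ (-(s : ℝ)) * δ ^ (-(s : ℝ)) := by
    intro δ hδ
    -- Chosen so that `2 * (4 * η / m) = δ`: the 4 comes from the packing estimate, the `2 / m` from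
    -- undoing the word map.
    set η := m / 8 * δ with hη
    have hη0 : 0 < η := mul_pos (by positivity) hδ.1
    have hη1 : η < δ₀ := by
      have := (lt_div_iff₀ hm0).1 hδ.2
      rw [hη]
      linarith
    have hδη : 2 * (4 * η / m) = δ := by rw [hη]; field_simp; norm_num
    have h1 := deltaCoverNumber_diagAffine_image_ge (F := F) (d := d) hm0 (min_le_left _ _)
      (min_le_right _ _) (mul_pos four_pos hη0)
    rw [← hd, hδη] at h1
    have h2 := h1.trans ((deltaCoverNumber_mono _ hw).trans
      (deltaCoverNumber_closure (hfinE _ (mul_pos four_pos hη0))))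
    refine (coverCount_le_of_le (hfinE _ (mul_pos four_pos hη0)) h2).trans ?_
    refine (hC η ⟨hη0, hη1⟩).trans (le_of_eq ?_)
    rw [hη, Real.mul_rpow (by positivity) hδ.1.le, mul_assoc]
  have hts := h.le_of_le_rpow (fun δ hδ => one_le_coverCount hne (hfin δ hδ))
    (by positivity) hbound
  rw [← ENNReal.ofReal_coe_nnreal]
  exact ENNReal.ofReal_le_ofReal hts

end LimitSet

/-! ### Assembling the estimates. -/

section MainTheorem

variable {I : Type*} {A : I → Plane → Plane} {a b : I → ℝ} {v : I → Plane} {F : Set Plane}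

theorem coverCount_wordMap_image_bounds (hA : ∀ i, A i = diagAffine (a i) (b i) (v i))
    (ha : ∀ i, a i ≠ 0) (hb : ∀ i, b i ≠ 0) (hF : F ⊆ unitSquare)
    (hmaps : ∀ i, MapsTo (A i) F F) (hfin : ∀ δ > 0, deltaCoverNumber δ F ≠ ⊤) {m δ : ℝ}
    (hδ : 0 < δ) {w : List I} (hw : AtScale (fun i => |a i|) (fun i => |b i|) m δ w) :
    coverCount (wordMap A w '' F) (2 * δ) ≤
      sliceCount (coverCount ((fun x : Plane => x 0) '' F))
        (coverCount ((fun x : Plane => x 1) '' F)) (fun i => |a i|) (fun i => |b i|) δ w ∧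
    sliceCount (coverCount ((fun x : Plane => x 0) '' F))
        (coverCount ((fun x : Plane => x 1) '' F)) (fun i => |a i|) (fun i => |b i|) δ w ≤
      coverCount (wordMap A w '' F) δ := by
  obtain ⟨d, hd⟩ := exists_wordMap_eq_diagAffine hA w
  have hfinw : deltaCoverNumber δ (wordMap A w '' F) ≠ ⊤ := by
    refine ne_top_of_le_ne_top (hfin δ hδ) (deltaCoverNumber_mono δ ?_)
    exact (mapsTo_wordMap hmaps w).image_subset
  have hα : 0 < |wordProd a w| := by
    rw [← wordProd_abs]; exact wordProd_pos (fun i => abs_pos.2 (ha i)) w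
  have hβ : 0 < |wordProd b w| := by
    rw [← wordProd_abs]; exact wordProd_pos (fun i => abs_pos.2 (hb i)) w
  have hproj : ∀ k : Fin 2, (fun x : Plane => x k) '' F ⊆ Icc 0 1 := by
    rintro k _ ⟨x, hx, rfl⟩
    exact hF hx k
  have hw2 := hw.2
  unfold sliceCount
  simp only [wordProd_abs] at hw2 ⊢
  rw [hd] at hfinw ⊢
  split_ifs with h
  · rw [min_eq_right h] at hw2
    exact ⟨coverCount_le_of_le
      (deltaCoverNumber_ne_top_of_subset_unitInterval (hproj 0) (div_pos hδ hα))
      (deltaCoverNumber_diagAffine_image_le_fst hF (abs_pos.1 hα) hδ hw2),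
      coverCount_le_of_le hfinw (deltaCoverNumber_fst_le_diagAffine_image (abs_pos.1 hα) hδ)⟩
  · rw [min_eq_left (not_le.1 h).le] at hw2
    exact ⟨coverCount_le_of_le
      (deltaCoverNumber_ne_top_of_subset_unitInterval (hproj 1) (div_pos hδ hβ))
      (deltaCoverNumber_diagAffine_image_le_snd hF (abs_pos.1 hβ) hδ hw2),
      coverCount_le_of_le hfinw (deltaCoverNumber_snd_le_diagAffine_image (abs_pos.1 hβ) hδ)⟩

theorem coverCount_le_sum_cylinders (hmaps : ∀ i, MapsTo (A i) F F)
    (hcov : ∀ x ∈ F, ∃ i, ∃ y ∈ F, A i y = x) (hfin : ∀ δ > 0, deltaCoverNumber δ F ≠ ⊤)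
    {T : Finset (List I)} (hT : CompleteFamily T) {δ : ℝ} (hδ : 0 < δ) :
    coverCount F δ ≤ ∑ w ∈ T, coverCount (wordMap A w '' F) δ := by
  have hsub : F ⊆ ⋃ w ∈ T, wordMap A w '' F := by
    intro x hx
    obtain ⟨w, hw, y, hy, rfl⟩ := hT.exists_wordMap_eq hcov hx
    exact mem_iUnion₂.2 ⟨w, hw, y, hy, rfl⟩
  have h := (deltaCoverNumber_mono δ hsub).trans (deltaCoverNumber_biUnion_le δ T _)
  have hw : ∀ w ∈ T, ((deltaCoverNumber δ (wordMap A w '' F)).toNat : ℕ∞) =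
      deltaCoverNumber δ (wordMap A w '' F) := fun w _ =>
    ENat.natCast_toNat (ne_top_of_le_ne_top (hfin δ hδ)
      (deltaCoverNumber_mono δ (mapsTo_wordMap hmaps w).image_subset))
  rw [← Finset.sum_congr rfl hw, ← Nat.cast_sum] at h
  refine (coverCount_le_of_le_nat h).trans (le_of_eq ?_)
  rw [Nat.cast_sum]
  rfl

/-- Each coordinate of the maps depends on that coordinate alone, so the projection is a
self-similar set, possibly with overlaps. -/
theorem exists_hasGrowth_projection [Fintype I] [Nonempty I] (k : Fin 2) {c : I → ℝ}
    (hk : ∀ i x, A i x k = c i * x k + v i k) (hF : F ⊆ unitSquare) (hne : F.Nonempty)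
    (hmaps : ∀ i, MapsTo (A i) F F) (hcov : ∀ x ∈ F, ∃ i, ∃ y ∈ F, A i y = x) {m : ℝ}
    (hm : 0 < m) (hmc : ∀ i, m ≤ |c i|) (hc : ∀ i, |c i| < 1) :
    ∃ r, HasGrowth (coverCount ((fun x : Plane => x k) '' F)) r := by
  refine exists_hasGrowth_of_selfSimilar (f := fun i x => c i * x + v i k) (a := c)
    (c := fun i => v i k) (fun i x => rfl) ?_ (hne.image _) ?_ ?_ hm hmc hc
  · rintro _ ⟨x, hx, rfl⟩
    exact hF hx k
  · rintro i _ ⟨x, hx, rfl⟩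
    exact ⟨A i x, hmaps i hx, hk i x⟩
  · rintro _ ⟨x, hx, rfl⟩
    obtain ⟨i, y, hy, rfl⟩ := hcov x hx
    exact ⟨i, y k, ⟨y, hy, rfl⟩, (hk i y).symm⟩

end MainTheorem

theorem mainTheorem5 {I : Type*} [Fintype I] [Nontrivial I]
    (a b : I → ℝ) (v : I → Plane) (A : I → Plane → Plane) (F : Set Plane)
    (ha : ∀ i, |a i| ∈ Ioo (0 : ℝ) 1) (hb : ∀ i, |b i| ∈ Ioo (0 : ℝ) 1)
    (hA : ∀ i, A i = diagAffine (a i) (b i) (v i))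
    (hmaps : ∀ i, MapsTo (A i) unitSquare unitSquare)
    (hrosc : ROSC A unitSquare)
    (hF : F = limitSet A unitSquare) :
    ∃ r₁ r₂ : ℝ,
      HasBoxDim ((fun x : Plane => x 0) '' F) r₁ ∧
      HasBoxDim ((fun x : Plane => x 1) '' F) r₂ ∧
      ∃ t : ℝ, 0 < t ∧
        max (∑ i, |a i| ^ r₁ * |b i| ^ (t - r₁)) (∑ i, |b i| ^ r₂ * |a i| ^ (t - r₂)) = 1 ∧
        (∀ s : ℝ, 0 < s →
          max (∑ i, |a i| ^ r₁ * |b i| ^ (s - r₁)) (∑ i, |b i| ^ r₂ * |a i| ^ (s - r₂)) = 1 →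
          s = t) ∧
        HasBoxDim F t ∧ packingDim F = ENNReal.ofReal t := by
  have ha0 : ∀ i, a i ≠ 0 := fun i => abs_pos.1 (ha i).1
  have hb0 : ∀ i, b i ≠ 0 := fun i => abs_pos.1 (hb i).1
  have ha1 : ∀ i, |a i| < 1 := fun i => (ha i).2
  have hb1 : ∀ i, |b i| < 1 := fun i => (hb i).2
  have hinj : ∀ i, Function.Injective (A i) := fun i => by
    rw [hA]; exact diagAffine_injective (ha0 i) (hb0 i) _
  have hFsub : F ⊆ unitSquare := hF ▸ limitSet_subset A unitSquare
  have hFne : F.Nonempty := hF ▸ limitSet_nonempty hA ha1 hb1 hmaps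
  have hFmaps : ∀ i, MapsTo (A i) F F := hF ▸ mapsTo_limitSet hmaps
  have hFcov : ∀ x ∈ F, ∃ i, ∃ y ∈ F, A i y = x := by
    rw [hF]; exact fun x hx => exists_eq_of_mem_limitSet hinj hx
  obtain ⟨m, hm, hma, hmb⟩ : ∃ m : ℝ, 0 < m ∧ (∀ i, m ≤ |a i|) ∧ ∀ i, m ≤ |b i| := by
    obtain ⟨i, hi⟩ := Finite.exists_min fun i => min |a i| |b i|
    exact ⟨_, lt_min (ha i).1 (hb i).1, fun j => (hi j).trans (min_le_left _ _),
      fun j => (hi j).trans (min_le_right _ _)⟩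
  have hproj : ∀ k : Fin 2, (fun x : Plane => x k) '' F ⊆ Icc 0 1 := by
    rintro k _ ⟨x, hx, rfl⟩
    exact hFsub hx k
  have hfinp : ∀ (k : Fin 2), ∀ δ > 0, deltaCoverNumber δ ((fun x : Plane => x k) '' F) ≠ ⊤ :=
    fun k δ hδ => deltaCoverNumber_ne_top_of_subset_unitInterval (hproj k) hδ
  have honep : ∀ (k : Fin 2) (δ : ℝ), 0 < δ → 1 ≤ coverCount ((fun x : Plane => x k) '' F) δ :=
    fun k δ hδ => one_le_coverCount (hFne.image _) (hfinp k δ hδ)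
  have hfin : ∀ δ > 0, deltaCoverNumber δ F ≠ ⊤ := by
    intro δ hδ
    have h := deltaCoverNumber_le_mul_projections (F := F) (half_pos hδ)
    rw [mul_div_cancel₀ _ two_ne_zero] at h
    exact ne_top_of_le_ne_top
      (WithTop.mul_ne_top (hfinp 0 _ (half_pos hδ)) (hfinp 1 _ (half_pos hδ))) h
  have hone : ∀ δ, 0 < δ → 1 ≤ coverCount F δ := fun δ hδ => one_le_coverCount hFne (hfin δ hδ)
  obtain ⟨r₁, h₁⟩ := exists_hasGrowth_projection 0 (fun i x => by rw [hA]; rfl) hFsub hFne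
    hFmaps hFcov hm hma ha1
  obtain ⟨r₂, h₂⟩ := exists_hasGrowth_projection 1 (fun i x => by rw [hA]; rfl) hFsub hFne
    hFmaps hFcov hm hmb hb1
  obtain ⟨t, ht0, ht⟩ := exists_max_sum_rpow_eq_one ha hb (h₁.nonneg (honep 0))
    (h₂.nonneg (honep 1))
  obtain ⟨p, q, hpq, hUsub, hUmaps, hUdisj⟩ := hrosc
  have hU : ∀ i, MapsTo (A i) (openRect p q) (openRect p q) := fun i =>
    mapsTo_iff_image_subset.2 (hUmaps i)
  have hFrect : ∀ x ∈ F, ∀ k, x k ∈ Icc (p k) (q k) := fun x hx k =>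
    limitSet_subset_closedRect hA ha1 hb1 hpq hUsub hU (hF ▸ hx) k
  obtain ⟨C, hC⟩ := exists_card_meeting_le hA ha0 hb0 hpq hU hUdisj hFrect hm
  have hgrowth : HasGrowth (coverCount F) t := by
    -- `C + 1` rather than `C`, because the constant must be positive.
    refine hasGrowth_of_sliceCount (K := C + 1) ha hb hm hma hmb h₁ h₂ (honep 0) (by positivity)
      ?_ ?_ ?_ ?_ hone ht
    · intro δ hδ T hT hTs
      refine (Finset.sum_le_sum fun w hw => (coverCount_wordMap_image_bounds hA ha0 hb0 hFsub
        hFmaps hfin hδ.1 (hTs w hw)).2).trans ?_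
      refine (sum_deltaCoverNumber_cylinders_le hFmaps (hfin δ hδ.1)
        (hC δ hδ.1 T hT fun w hw => ?_)).trans ?_
      · have h := (hTs w hw).1
        simp only [wordProd_abs] at h
        exact lt_min_iff.1 h
      · linarith [hone δ hδ.1]
    · intro δ hδ T hT hTs
      refine (coverCount_le_sum_cylinders hFmaps hFcov hfin hT (mul_pos two_pos hδ.1)).trans ?_
      exact Finset.sum_le_sum fun w hw => (coverCount_wordMap_image_bounds hA ha0 hb0 hFsub
        hFmaps hfin hδ.1 (hTs w hw)).1
    · intro δ hδ
      have h := ENat.toNat_le_toNat (deltaCoverNumber_le_mul_projections (F := F) hδ)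
        (WithTop.mul_ne_top (hfinp 0 δ hδ) (hfinp 1 δ hδ))
      rw [ENat.toNat_mul] at h
      unfold coverCount
      exact_mod_cast h
    · intro δ δ' hδ h
      exact coverCount_le_of_le (hfin δ hδ) (deltaCoverNumber_anti F h)
  refine ⟨r₁, r₂, h₁.hasBoxDim (hFne.image _) (hfinp 0), h₂.hasBoxDim (hFne.image _) (hfinp 1),
    t, ht0, ht, fun s _ hs => ?_, hgrowth.hasBoxDim hFne hfin,
    le_antisymm (packingDim_le_of_hasGrowth hfin hgrowth) ?_⟩
  · exact (max_sum_rpow_strictAnti ha hb r₁ r₂).injective (hs.trans ht.symm)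
  · subst hF
    exact le_packingDim_limitSet hA ha0 hb0 ha1 hb1 hmaps hfin hgrowth
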